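/- Let $\mathcal G=(V,E)$ be a finite graph without self-loops (multiple edges are allowed), with a set $V_b\subset V$ of $k\ge 2$ boundary vertices; the other vertices are called interior. Assume that every edge has at least one interior end, and that every interior vertex is joined by an edge to every boundary vertex. Fix distinct boundary values $b_v\in\mathbb C$, $v\in V_b$. For a function $q:E\to\mathbb R$ consider the conditions $$\text{(qsum)}\quad \sum_v q_{uv}=0\qquad\text{and}\qquad \text{(zsum)}\quad \sum_v \frac{q_{uv}}{z_u-z_v}=0\qquad\text{for every interior vertex } u,$$ where the sums run over the edges $uv$ at $u$. A function $q$ satisfying (qsum) is called generic if its values are algebraically independent modulo (qsum) over the field $\mathbb Q(b_v: v\in V_b)$, that is, every polynomial in the variables $(q_e)_{e\in E}$ with coefficients in this field that vanishes at $q$ vanishes at every real solution of (qsum). A solution of (zsum) is a function $z:V\to\mathbb C$ with $z_v=b_v$ for $v\in V_b$, with $z_u\ne z_v$ for every edge $uv$, and satisfying (zsum); in particular a graph with a self-loop has no solutions. Let $e$ be an edge of $\mathcal G$ between two interior vertices. Let $\mathcal G-e$ be the graph with $e$ deleted, and $\mathcal G/e$ the multigraph obtained by removing $e$ and identifying its two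 ends (keeping all other edges, so that multiple edges and self-loops may arise), both with the same boundary and the same boundary values. Then for each $\mathcal H\in\{\mathcal G,\ \mathcal G-e,\ \mathcal G/e\}$ generic functions $q$ on the edges of $\mathcal H$ exist, the number of solutions of (zsum) on $\mathcal H$ is finite and is the same number $N(\mathcal H)$ for all of them, and $$N(\mathcal G)=N(\mathcal G-e)+N(\mathcal G/e).$$ -/

import Mathlib

noncomputable section

namespace HQD

universe u v

variable {α : Type u} {β : Type v}

/-- The contraction `G / e` of an edge `e` with ends `x` and `y`: remove `e` and identify `y`
with `x`. The merged vertex keeps the name `x`. All other edges survive, so parallel edges may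
arise, and an edge parallel to `e` becomes a self-loop. -/
def contract (G : Graph α β) (e : β) (x y : α) : Graph α β :=
  open Classical in
  (G.deleteEdges {e}).map (Function.update id y x)

/-- The condition `∑_v q_{uv} = 0` at every interior vertex `u`, where `B` is the set of boundary
vertices. The sum is over all pairs `(e, v)` such that `e` is an edge from `u` to `v`. -/
def QSum (G : Graph α β) (B : Set α) (q : G.edgeSet → ℝ) : Prop :=
  ∀ u : G.vertexSet, (u : α) ∉ B →
    ∑ᶠ (p : G.edgeSet × G.vertexSet) (_ : G.IsLink p.1 u p.2), q p.1 = 0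

/-- The set of solutions `z : V → ℂ` of the equations `∑_v q_{uv} / (z_u - z_v) = 0`, one for
each interior vertex `u`, with prescribed values `b` on the set `B` of boundary vertices. The
equations presuppose that no denominator vanishes, that is, that `z` takes distinct values at
the two ends of every edge; in particular a graph with a self-loop has no solution. -/
def solutions (G : Graph α β) (B : Set α) (b : B → ℂ) (q : G.edgeSet → ℝ) :
    Set (G.vertexSet → ℂ) :=
  {z | (∀ (v : G.vertexSet) (hv : (v : α) ∈ B), z v = b ⟨v, hv⟩) ∧
    (∀ (e : β) (u v : G.vertexSet), G.IsLink e u v → z u ≠ z v) ∧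
    ∀ u : G.vertexSet, (u : α) ∉ B →
      ∑ᶠ (p : G.edgeSet × G.vertexSet) (_ : G.IsLink p.1 u p.2),
        (q p.1 : ℂ) / (z u - z p.2) = 0}

/-- A real function `q` on the edges is generic subject to the linear condition `QSum` if it
satisfies this condition and its values are algebraically independent modulo this condition:
a polynomial that vanishes at `q` vanishes at every `q'` which satisfies `QSum`.
The polynomials have their coefficients in the field generated over `ℚ` by the prescribed
boundary values `b`. -/
def IsGeneric (G : Graph α β) (B : Set α) (b : B → ℂ) (q : G.edgeSet → ℝ) : Prop :=
  QSum G B q ∧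
    ∀ P : MvPolynomial G.edgeSet (IntermediateField.adjoin ℚ (Set.range b)),
      MvPolynomial.aeval (fun e => (q e : ℂ)) P = 0 →
        ∀ q' : G.edgeSet → ℝ, QSum G B q' → MvPolynomial.aeval (fun e => (q' e : ℂ)) P = 0

/-- `n` is the number `N(G)` of solutions for generic `q`: generic functions `q` exist, and for
every one of them the number of solutions is finite and equal to `n`. -/
def IsGenericCount (G : Graph α β) (B : Set α) (b : B → ℂ) (n : ℕ) : Prop :=
  (∃ q : G.edgeSet → ℝ, IsGeneric G B b q) ∧
    ∀ q : G.edgeSet → ℝ, IsGeneric G B b q → (solutions G B b q).encard = n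

end HQD

end

/-! Write `x`, `y` for the ends of `e`, and `F_u` and `Q_u` for the sums in (zsum) and (qsum) taken
over the edges of `G - e` at `u`. If `q_e ≠ 0`, then (qsum) says `Q_x = Q_y = -q_e`, and (zsum) at
`x` and `y` becomes `F_x + F_y = 0` together with `(z_x - z_y) F_x = Q_x`. This relaxed system no
longer mentions `e` and makes sense when `z_x = z_y`. Let `q_e → 0`. Its last equation degenerates
to `(z_x - z_y) F_x = 0`, so the limiting solutions split into those with `F_x = F_y = 0`, the
solutions on `G - e`, and those with `z_x = z_y`, the solutions on `G/e`. The recurrence follows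
once no solution is lost, gained or counted twice in the limit.

The base point is a generic `q₀` on `G - e`. It also satisfies the condition of `G` with `q_e = 0`
and that of `G/e`, but need not be generic for either. The relaxed systems `(l, m) = (1, 0)` and
`(0, 1)` (the latter is `z_x = z_y`) are therefore studied near `q₀`. Their number of solutions is
locally constant (`encard_zeros_eventually_eq`), and generic functions of `G` and `G/e` occur
arbitrarily close to `q₀` by Baire's theorem. Two generic functions on one graph are conjugate under
a field automorphism of `ℂ` that fixes the boundary values, so a single one determines the count.

Local constancy needs two facts at `q₀`.

Nondegeneracy: by genericity, every admissible direction `d` is `D q₀` for a derivation `D` of `ℂ`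
(`GenericIn.exists_derivation`). Applying `D` to an equation satisfied by `z` shows that the
differential in `z` reaches the effect of varying the weights. Moving weight between two boundary
edges at `u` varies the equation at `u` alone, because the boundary values are distinct; so the
differential is onto (`GenericIn.relaxedDeriv_bijective`). The same argument excludes overdetermined
systems, in particular `z_x = z_y` together with `F_x = F_y = 0`.

Properness: if the ends of an edge collide in the limit, testing the equations against `z` on the
colliding cluster makes the sum of `q₀` inside the cluster vanish, which genericity forbids. If the
vertices of a set `S` escape to infinity, testing against `z²` on `S` and using (qsum) gives one
extra linear relation among the bounded vertices, and the system becomes overdetermined. -/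

noncomputable section

namespace HQD

open Filter Topology

section

/-! ### Lifting through square-zero extensions and extending isomorphisms -/

/-- A field of characteristic zero is formally smooth over every subring. -/
lemma formallySmooth_of_injective {A C : Type*} [CommRing A] [IsDomain A] [Field C] [CharZero C]
    [Algebra A C] [FaithfulSMul A C] : Algebra.FormallySmooth A C := by
  let F := FractionRing A
  let : Algebra F C := FractionRing.liftAlgebra A C
  have : IsScalarTower A F C := FractionRing.isScalarTower_liftAlgebra A C
  have : CharZero F := by
    refine ⟨fun m n h => ?_⟩
    have h' := congrArg (algebraMap F C) h
    rw [map_natCast, map_natCast] at h'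
    exact Nat.cast_injective h'
  have : Algebra.FormallySmooth F C := by
    obtain ⟨s, hs⟩ := exists_isTranscendenceBasis F C
    have : Algebra.IsAlgebraic (IntermediateField.adjoin F (Set.range ((↑) : s → C))) C :=
      hs.isAlgebraic_field
    have : CharZero (IntermediateField.adjoin F (Set.range ((↑) : s → C))) := inferInstance
    exact .of_algebraicIndependent_of_isSeparable hs.1
  have : Algebra.FormallySmooth A F := .of_isLocalization (nonZeroDivisors A)
  exact .comp A F C

/-- Formal smoothness of `C` over `A` lifts the identity of `C` through the nilpotent extension `p`,
compatibly with `g`. -/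
lemma exists_ringHom_section {A B C : Type*} [CommRing A] [IsDomain A] [CommRing B] [Field C]
    [CharZero C] (f : A →+* C) (hf : Function.Injective f) (g : A →+* B) (p : B →+* C)
    (hp : Function.Surjective p) (hnil : IsNilpotent (RingHom.ker p)) (hpg : p.comp g = f) :
    ∃ φ : C →+* B, (∀ c, p (φ c) = c) ∧ ∀ a, φ (f a) = g a := by
  let : Algebra A C := f.toAlgebra
  let : Algebra A B := g.toAlgebra
  have : FaithfulSMul A C := (faithfulSMul_iff_algebraMap_injective A C).2 hf
  have := formallySmooth_of_injective (A := A) (C := C)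
  let p' : B →ₐ[A] C := { p with commutes' := fun a => RingHom.congr_fun hpg a }
  refine ⟨(Algebra.FormallySmooth.liftOfSurjective (AlgHom.id A C) p' hp hnil : C →ₐ[A] B), ?_, ?_⟩
  · intro c
    exact Algebra.FormallySmooth.liftOfSurjective_apply (AlgHom.id A C) p' hp hnil c
  · intro a
    exact (Algebra.FormallySmooth.liftOfSurjective (AlgHom.id A C) p' hp hnil).commutes a

lemma exists_ringHom_section_of_ker_le {R B C : Type*} [CommRing R] [CommRing B] [Field C]
    [CharZero C] (f : R →+* C) (g : R →+* B) (hfg : ∀ r, f r = 0 → g r = 0) (p : B →+* C)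
    (hp : Function.Surjective p) (hnil : IsNilpotent (RingHom.ker p)) (hpg : p.comp g = f) :
    ∃ φ : C →+* B, (∀ c, p (φ c) = c) ∧ ∀ r, φ (f r) = g r := by
  have : (RingHom.ker f).IsPrime := RingHom.ker_isPrime _
  obtain ⟨φ, h1, h2⟩ := exists_ringHom_section (RingHom.kerLift f) (RingHom.kerLift_injective f)
    (Ideal.Quotient.lift (RingHom.ker f) g hfg) p hp hnil
    (Ideal.Quotient.ringHom_ext (by ext r; exact RingHom.congr_fun hpg r))
  exact ⟨φ, h1, fun r => h2 (Ideal.Quotient.mk _ r)⟩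

open Cardinal in
/-- Two embeddings of a countable ring in an uncountable algebraically closed field differ by an
automorphism of the field. -/
lemma exists_ringEquiv_of_injective {R K L : Type*} [CommRing R] [Countable R] [Field K] [Field L]
    [IsAlgClosed K] [IsAlgClosed L] (hK : ℵ₀ < #K) (hL : ℵ₀ < #L) (hKL : Nonempty (K ≃ L))
    (f : R →+* K) (hf : Function.Injective f) (g : R →+* L) (hg : Function.Injective g) :
    ∃ τ : K ≃+* L, ∀ r, τ (f r) = g r := by
  let : Algebra R K := f.toAlgebra
  let : Algebra R L := g.toAlgebra
  have : FaithfulSMul R K := (faithfulSMul_iff_algebraMap_injective R K).2 hf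
  have : FaithfulSMul R L := (faithfulSMul_iff_algebraMap_injective R L).2 hg
  have : Nontrivial R := RingHom.domain_nontrivial f
  obtain ⟨s, hs⟩ := exists_isTranscendenceBasis R K
  obtain ⟨t, ht⟩ := exists_isTranscendenceBasis R L
  -- Over a countable ring, a transcendence basis of an uncountable algebraically closed field has
  -- the cardinality of the field. So the two bases are equinumerous, and the isomorphism of
  -- polynomial rings extends to algebraic closures.
  have h1 := IsAlgClosed.cardinal_eq_cardinal_transcendence_basis_of_aleph0_lt _ hs
    (mk_le_aleph0 (α := R)) hK
  have h2 := IsAlgClosed.cardinal_eq_cardinal_transcendence_basis_of_aleph0_lt _ ht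
    (mk_le_aleph0 (α := R)) hL
  have h3 := Cardinal.lift_mk_eq'.2 hKL
  have : Nonempty (s ≃ t) := by
    rw [← Cardinal.lift_mk_eq', ← lift_injective h1, ← lift_injective h2]
    exact h3
  obtain ⟨e⟩ := this
  let := IsAlgClosed.isAlgClosure_of_transcendence_basis _ hs
  let := IsAlgClosed.isAlgClosure_of_transcendence_basis _ ht
  let e' : Algebra.adjoin R (Set.range ((↑) : s → K)) ≃ₐ[R]
      Algebra.adjoin R (Set.range ((↑) : t → L)) :=
    (hs.1.aevalEquiv.symm.trans (MvPolynomial.renameEquiv R e)).trans ht.1.aevalEquiv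
  refine ⟨IsAlgClosure.equivOfEquiv K L e'.toRingEquiv, fun r => ?_⟩
  have := IsAlgClosure.equivOfEquiv_algebraMap K L e'.toRingEquiv (algebraMap R _ r)
  have h4 : e'.toRingEquiv (algebraMap R _ r) = algebraMap R _ r := e'.commutes r
  rw [h4] at this
  exact this

open Cardinal in
lemma exists_ringEquiv_of_ker_eq {R K : Type*} [CommRing R] [Countable R] [Field K]
    [IsAlgClosed K] (hK : ℵ₀ < #K) (f g : R →+* K) (hfg : ∀ r, f r = 0 ↔ g r = 0) :
    ∃ τ : K ≃+* K, ∀ r, τ (f r) = g r := by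
  have : Countable (R ⧸ RingHom.ker f) := Ideal.Quotient.mk_surjective.countable
  have hg : Function.Injective
      (Ideal.Quotient.lift (RingHom.ker f) g fun r hr => (hfg r).1 hr) := by
    rw [injective_iff_map_eq_zero]
    intro a
    obtain ⟨r, rfl⟩ := Ideal.Quotient.mk_surjective a
    exact fun h => Ideal.Quotient.eq_zero_iff_mem.2 ((hfg r).2 h)
  obtain ⟨τ, hτ⟩ := exists_ringEquiv_of_injective hK hK ⟨Equiv.refl K⟩ (RingHom.kerLift f)
    (RingHom.kerLift_injective f) _ hg
  exact ⟨τ, fun r => hτ (Ideal.Quotient.mk _ r)⟩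

/-! ### Generic points of real linear spaces -/

variable {E : Type*}

/-- `q` lies in `L` and satisfies no polynomial relation over `k` beyond those of `L`. -/
def GenericIn (k : IntermediateField ℚ ℂ) (L : Submodule ℝ (E → ℝ)) (q : E → ℝ) : Prop :=
  q ∈ L ∧ ∀ P : MvPolynomial E k, MvPolynomial.aeval (fun e => (q e : ℂ)) P = 0 →
    ∀ q' ∈ L, MvPolynomial.aeval (fun e => (q' e : ℂ)) P = 0

/-- The restriction of a polynomial to the line through `q` in the direction `d`. -/
def linePoly {k : IntermediateField ℚ ℂ} (P : MvPolynomial E k) (q d : E → ℝ) : Polynomial ℂ :=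
  MvPolynomial.aeval
    (fun e => Polynomial.C (q e : ℂ) + Polynomial.X * Polynomial.C (d e : ℂ)) P

variable {k : IntermediateField ℚ ℂ}

lemma aeval_linePoly {A : Type*} [CommRing A] [Algebra ℂ A] (P : MvPolynomial E k) (q d : E → ℝ)
    (a : A) : Polynomial.aeval a (linePoly P q d) =
      MvPolynomial.aeval (fun e => algebraMap ℂ A (q e : ℂ) + a * algebraMap ℂ A (d e : ℂ)) P := by
  have h := MvPolynomial.map_aeval
    (fun e => Polynomial.C (q e : ℂ) + Polynomial.X * Polynomial.C (d e : ℂ))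
    (Polynomial.aeval (R := ℂ) a).toRingHom P
  simp only [AlgHom.toRingHom_eq_coe, RingHom.coe_coe, map_add, map_mul, Polynomial.aeval_C,
    Polynomial.aeval_X] at h
  rw [linePoly, h, MvPolynomial.aeval_def, MvPolynomial.coe_eval₂Hom]
  congr 1
  ext x
  simp [IsScalarTower.algebraMap_apply k ℂ A]

lemma eval_linePoly (P : MvPolynomial E k) (q d : E → ℝ) (t : ℝ) :
    (linePoly P q d).eval (t : ℂ) =
      MvPolynomial.aeval (fun e => ((q e + t * d e : ℝ) : ℂ)) P := by
  rw [← Polynomial.coe_aeval_eq_eval, aeval_linePoly]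
  simp

/-- Vanishing at the infinitely many real parameters kills the polynomial itself, so other values,
such as `ε` in the dual numbers, can then be substituted. -/
lemma linePoly_eq_zero {P : MvPolynomial E k} {q d : E → ℝ}
    (h : ∀ t : ℝ, MvPolynomial.aeval (fun e => ((q e + t * d e : ℝ) : ℂ)) P = 0) :
    linePoly P q d = 0 := by
  refine Polynomial.eq_zero_of_infinite_isRoot _
    (((Set.infinite_range_of_injective Complex.ofReal_injective)).mono ?_)
  rintro _ ⟨t, rfl⟩
  exact (eval_linePoly P q d t).trans (h t)

lemma mvPolynomial_countable [Finite E] [Countable k] : Countable (MvPolynomial E k) := by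
  rw [← Cardinal.mk_le_aleph0_iff]
  refine MvPolynomial.cardinalMk_le_max_lift.trans ?_
  simp

/-- Generic points are dense in every linear space. -/
lemma GenericIn.exists_mem_nhds [Finite E] [Countable k] (L : Submodule ℝ (E → ℝ)) {q₀ : E → ℝ}
    (hq₀ : q₀ ∈ L) {U : Set (E → ℝ)} (hU : U ∈ 𝓝 q₀) : ∃ q ∈ U, GenericIn k L q := by
  have := mvPolynomial_countable (E := E) (k := k)
  have := Fintype.ofFinite E
  -- Baire's theorem in `L`: there are countably many polynomials that do not vanish identically on
  -- `L`, and each is nonzero on an open dense subset, because on the line from any `q` to a point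
  -- where it is nonzero it has finitely many zeros.
  let ι := {P : MvPolynomial E k //
    ∃ q' ∈ L, MvPolynomial.aeval (fun e => (q' e : ℂ)) P ≠ 0}
  let f : ι → Set L := fun P => {q | MvPolynomial.aeval (fun e => ((q : E → ℝ) e : ℂ)) P.1 ≠ 0}
  have hopen : ∀ P, IsOpen (f P) := by
    intro P
    refine isOpen_ne_fun ?_ continuous_const
    simp only [MvPolynomial.aeval_def, MvPolynomial.eval₂_eq]
    refine continuous_finsetSum _ fun m _ => continuous_const.mul
      (continuous_finsetProd _ fun i _ => Continuous.pow ?_ _)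
    exact Complex.continuous_ofReal.comp ((continuous_apply i).comp continuous_subtype_val)
  have hdense : ∀ P, Dense (f P) := by
    rintro ⟨P, q₁, hq₁, hP⟩ q
    have hne : linePoly P q (q₁ - q) ≠ 0 := by
      intro h0
      apply hP
      have := eval_linePoly P q (q₁ - q) 1
      rw [h0, Polynomial.eval_zero] at this
      rw [this]
      simp
    have hfin : {t : ℝ | (linePoly P q (q₁ - q)).IsRoot (t : ℂ)}.Finite :=
      (Polynomial.finite_setOfPred_isRoot hne).preimage Complex.ofReal_injective.injOn
    have hev : ∀ᶠ t : ℝ in 𝓝[≠] 0, (linePoly P q (q₁ - q)).eval (t : ℂ) ≠ 0 := by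
      have : {t : ℝ | (linePoly P q (q₁ - q)).IsRoot (t : ℂ)}ᶜ ∈ 𝓝[≠] (0 : ℝ) :=
        nhdsNE_le_cofinite _ (hfin.compl_mem_cofinite)
      exact this
    have hcont : Tendsto (fun t : ℝ => q + t • ((⟨q₁, hq₁⟩ : L) - q)) (𝓝[≠] 0) (𝓝 q) := by
      have : Continuous (fun t : ℝ => q + t • ((⟨q₁, hq₁⟩ : L) - q)) := by fun_prop
      have h := this.tendsto 0
      simp only [zero_smul, add_zero] at h
      exact h.mono_left nhdsWithin_le_nhds
    refine mem_closure_of_tendsto hcont (hev.mono fun t ht => ?_)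
    rw [eval_linePoly] at ht
    exact ht
  have hd := dense_iInter_of_isOpen hopen hdense
  have hU' : ((↑) : L → E → ℝ) ⁻¹' U ∈ 𝓝 (⟨q₀, hq₀⟩ : L) :=
    continuous_subtype_val.continuousAt.preimage_mem_nhds hU
  obtain ⟨q, hq, hqU⟩ := mem_closure_iff_nhds.1 (hd ⟨q₀, hq₀⟩) _ hU'
  refine ⟨q, hq, q.2, fun P hP q' hq' => ?_⟩
  by_contra hne
  exact Set.mem_iInter.1 hqU ⟨P, q', hq', hne⟩ hP

/-- Every tangent direction at a generic point is realized by a derivation of `ℂ` over `k`. -/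
lemma GenericIn.exists_derivation {L : Submodule ℝ (E → ℝ)} {q : E → ℝ}
    (hq : GenericIn k L q) {d : E → ℝ} (hd : d ∈ L) :
    ∃ D : Derivation k ℂ ℂ, ∀ e, D (q e : ℂ) = d e := by
  let ev : MvPolynomial E k →ₐ[k] ℂ := MvPolynomial.aeval (fun e => (q e : ℂ))
  let ψ : MvPolynomial E k →ₐ[k] DualNumber ℂ := MvPolynomial.aeval
    (fun e => algebraMap ℂ (DualNumber ℂ) (q e : ℂ) +
      DualNumber.eps * algebraMap ℂ (DualNumber ℂ) (d e : ℂ))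
  -- A relation at `q` holds on all of `L`, hence along `q + t d` for real `t`, hence for `t = ε`.
  -- So `q ↦ q + ε d` is well defined on the ring generated by the values of `q`. It extends to a
  -- section `ℂ → ℂ[ε]`, whose second component is the derivation.
  have hker : ∀ P, ev P = 0 → ψ P = 0 := by
    intro P hP
    have h0 : linePoly P q d = 0 := linePoly_eq_zero fun t => by
      have := hq.2 P hP (q + t • d) (L.add_mem hq.1 (L.smul_mem t hd))
      simpa using this
    have := aeval_linePoly P q d (DualNumber.eps : DualNumber ℂ)
    rw [h0, map_zero] at this
    exact this.symm
  let p : DualNumber ℂ →+* ℂ := (TrivSqZeroExt.fstHom ℂ ℂ ℂ).toRingHom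
  have hnil : IsNilpotent (RingHom.ker p) := by
    refine ⟨2, (pow_two (RingHom.ker p)).trans ?_⟩
    rw [Ideal.zero_eq_bot, eq_bot_iff, Ideal.mul_le]
    intro r hr s hs
    have hr' : r.fst = 0 := hr
    have hs' : s.fst = 0 := hs
    rw [Ideal.mem_bot]
    ext <;> simp [hr', hs']
  have hpg : p.comp ψ.toRingHom = ev.toRingHom := by
    refine MvPolynomial.ringHom_ext (fun a => ?_) (fun e => ?_)
    · change TrivSqZeroExt.fst (ψ (MvPolynomial.C a)) = ev (MvPolynomial.C a)
      rw [MvPolynomial.algHom_C, MvPolynomial.algHom_C]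
      rfl
    · change TrivSqZeroExt.fst (ψ (MvPolynomial.X e)) = ev (MvPolynomial.X e)
      simp [ψ, ev, TrivSqZeroExt.algebraMap_eq_inl']
  obtain ⟨φ, hφ1, hφ2⟩ := exists_ringHom_section_of_ker_le ev.toRingHom ψ.toRingHom hker p
    (fun c => ⟨TrivSqZeroExt.inl c, rfl⟩) hnil hpg
  have hfst : ∀ c, (φ c).fst = c := hφ1
  have hsnd : ∀ a : k, (φ (a : ℂ)).snd = 0 := by
    intro a
    have h : φ (ev (MvPolynomial.C a)) = ψ (MvPolynomial.C a) := hφ2 (MvPolynomial.C a)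
    rw [MvPolynomial.algHom_C, MvPolynomial.algHom_C] at h
    exact congrArg TrivSqZeroExt.snd h
  refine ⟨Derivation.mk' { toFun := fun c => (φ c).snd, map_add' := ?_, map_smul' := ?_ } ?_, ?_⟩
  · intro a b
    simp
  · intro a c
    have : a • c = (a : ℂ) * c := rfl
    rw [this, map_mul, TrivSqZeroExt.snd_mul, hfst, hfst, hsnd]
    simp; rfl
  · intro a b
    simp [TrivSqZeroExt.snd_mul, hfst, mul_comm]
  · intro e
    have h : φ (ev (MvPolynomial.X e)) = ψ (MvPolynomial.X e) := hφ2 (MvPolynomial.X e)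
    simp only [ev, ψ, MvPolynomial.aeval_X] at h
    change (φ (q e : ℂ)).snd = d e
    rw [h]
    simp [TrivSqZeroExt.algebraMap_eq_inl']

/-- Any two generic points are conjugate under the automorphisms of `ℂ` over `k`. -/
lemma GenericIn.exists_ringEquiv [Finite E] [Countable k] {L : Submodule ℝ (E → ℝ)}
    {q q' : E → ℝ} (hq : GenericIn k L q) (hq' : GenericIn k L q') :
    ∃ τ : ℂ ≃+* ℂ, (∀ a : k, τ a = a) ∧ ∀ e, τ (q e) = q' e := by
  have := mvPolynomial_countable (E := E) (k := k)
  let ev : MvPolynomial E k →ₐ[k] ℂ := MvPolynomial.aeval (fun e => (q e : ℂ))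
  let ev' : MvPolynomial E k →ₐ[k] ℂ := MvPolynomial.aeval (fun e => (q' e : ℂ))
  have hC : Cardinal.aleph0 < Cardinal.mk ℂ := by
    rw [Cardinal.mk_complex]; exact Cardinal.aleph0_lt_continuum
  -- Both evaluations have the same kernel, the polynomials that vanish on `L`.
  obtain ⟨τ, hτ⟩ := exists_ringEquiv_of_ker_eq hC ev.toRingHom ev'.toRingHom
    fun P => ⟨fun h => hq.2 P h q' hq'.1, fun h => hq'.2 P h q hq.1⟩
  refine ⟨τ, fun a => ?_, fun e => ?_⟩
  · have h : τ (ev (MvPolynomial.C a)) = ev' (MvPolynomial.C a) := hτ (MvPolynomial.C a)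
    rwa [MvPolynomial.algHom_C, MvPolynomial.algHom_C] at h
  · have h : τ (ev (MvPolynomial.X e)) = ev' (MvPolynomial.X e) := hτ (MvPolynomial.X e)
    simpa [ev, ev'] using h

lemma countable_adjoin {S : Set ℂ} (hS : S.Countable) :
    Countable (IntermediateField.adjoin ℚ S) := by
  rw [← Cardinal.mk_le_aleph0_iff]
  have := IntermediateField.lift_cardinalMk_adjoin_le ℚ S
  have hS' : Cardinal.mk S ≤ Cardinal.aleph0 := Cardinal.mk_le_aleph0_iff.2 hS
  simpa [hS'] using this

end

/-! ### Local constancy of the number of zeros -/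

section

/-- If all zeros of `F (q₀, ·)` in an open set are nondegenerate and the zeros of `F (q, ·)`
accumulate, for `q → q₀` in `P₀`, only at zeros of `F (q₀, ·)`, then there are finitely many zeros
at `q₀` and their number does not change near `q₀`. -/
theorem encard_zeros_eventually_eq {P W : Type*} [NormedAddCommGroup P] [NormedSpace ℂ P]
    [CompleteSpace P] [NormedAddCommGroup W] [NormedSpace ℂ W] [CompleteSpace W]
    (F : P × W → W) (U : Set (P × W)) (hU : IsOpen U) (P₀ : Set P) (q₀ : P) (hq₀ : q₀ ∈ P₀)
    (hd : ∀ z, (q₀, z) ∈ U → F (q₀, z) = 0 → ∃ F' : P × W →L[ℂ] W,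
      HasStrictFDerivAt F F' (q₀, z) ∧ (F' ∘L .inr ℂ P W).IsInvertible)
    (hproper : ∀ 𝒰 : Ultrafilter (P × W), Tendsto Prod.fst (𝒰 : Filter (P × W)) (𝓝[P₀] q₀) →
      (∀ᶠ p in (𝒰 : Filter (P × W)), p ∈ U ∧ F p = 0) →
      ∃ z, ((q₀, z) ∈ U ∧ F (q₀, z) = 0) ∧ Tendsto Prod.snd (𝒰 : Filter (P × W)) (𝓝 z)) :
    {z | (q₀, z) ∈ U ∧ F (q₀, z) = 0}.Finite ∧
      ∀ᶠ q in 𝓝[P₀] q₀, {z | (q, z) ∈ U ∧ F (q, z) = 0}.encard =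
        {z | (q₀, z) ∈ U ∧ F (q₀, z) = 0}.encard := by
  let S : P → Set W := fun q => {z | (q, z) ∈ U ∧ F (q, z) = 0}
  have hloc : ∀ z, z ∈ S q₀ → ∃ ψ : P → W, Tendsto ψ (𝓝 q₀) (𝓝 z) ∧
      ∀ᶠ v in 𝓝 (q₀, z), v.2 ∈ S v.1 ↔ ψ v.1 = v.2 := by
    rintro z ⟨hzU, hz⟩
    obtain ⟨F', h1, h2⟩ := hd z hzU hz
    refine ⟨h1.implicitFunctionOfProdDomain h2,
      h1.tendsto_implicitFunctionOfProdDomain h2, ?_⟩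
    filter_upwards [h1.eventually_apply_eq_iff_implicitFunctionOfProdDomain h2,
      hU.mem_nhds hzU] with v hv hvU
    rw [← hv, hz]
    exact ⟨fun h => h.2, fun h => ⟨hvU, h⟩⟩
  -- An ultrafilter on infinitely many zeros that contains no finite set would converge to a zero,
  -- near which the implicit function theorem allows only one.
  have hfin : (S q₀).Finite := by
    by_contra hinf
    have : (cofinite ⊓ 𝓟 (S q₀)).NeBot := Set.Infinite.cofinite_inf_principal_neBot hinf
    let 𝒱 := Ultrafilter.of (cofinite ⊓ 𝓟 (S q₀))
    have h𝒱 : (𝒱 : Filter W) ≤ cofinite ⊓ 𝓟 (S q₀) := Ultrafilter.of_le _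
    have hS : ∀ᶠ z in (𝒱 : Filter W), z ∈ S q₀ := (h𝒱.trans inf_le_right) (mem_principal_self _)
    obtain ⟨z, hz, hlim⟩ := hproper (𝒱.map fun z => (q₀, z))
      (by
        rw [Ultrafilter.coe_map, tendsto_map'_iff]
        exact (tendsto_const_nhdsWithin hq₀))
      (by rw [Ultrafilter.coe_map, eventually_map]; exact hS)
    rw [Ultrafilter.coe_map, tendsto_map'_iff] at hlim
    obtain ⟨ψ, -, hψ⟩ := hloc z hz
    have hlim' : Tendsto (fun z => (q₀, z)) (𝒱 : Filter W) (𝓝 (q₀, z)) :=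
      tendsto_const_nhds.prodMk_nhds hlim
    have h1 : ∀ᶠ w in (𝒱 : Filter W), w = ψ q₀ := by
      filter_upwards [hlim'.eventually hψ, hS] with w hw hwS
      exact (hw.1 hwS).symm
    have h2 : ∀ᶠ w in (𝒱 : Filter W), w ≠ ψ q₀ :=
      (h𝒱.trans inf_le_left) (Set.finite_singleton (ψ q₀)).compl_mem_cofinite
    obtain ⟨w, hw1, hw2⟩ := (h1.and h2).exists
    exact hw2 hw1
  refine ⟨hfin, ?_⟩
  obtain ⟨N, hN, hdisj⟩ := hfin.t2_separation
  choose! ψ hψ hiff using hloc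
  have hprod : ∀ z ∈ S q₀, ∃ B ∈ 𝓝 z, ∀ᶠ q in 𝓝 q₀, ∀ w ∈ B, w ∈ S q ↔ ψ z q = w := by
    intro z hz
    have := hiff z hz
    rw [nhds_prod_eq, eventually_prod_iff] at this
    obtain ⟨pa, ha, pb, hb, h⟩ := this
    exact ⟨{w | pb w}, hb, ha.mono fun q hq w hw => h hq hw⟩
  choose! B hB hBiff using hprod
  let O : Set W := ⋃ z ∈ S q₀, B z ∩ N z
  have hO : ∀ z ∈ S q₀, O ∈ 𝓝 z := fun z hz =>
    mem_of_superset (inter_mem (hB z hz) ((hN z).2.mem_nhds (hN z).1))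
      (Set.subset_biUnion_of_mem (u := fun z => B z ∩ N z) hz)
  -- Zeros outside `O` for `q` arbitrarily close to `q₀` would, by properness, converge to a zero at
  -- `q₀`, but `O` is a neighbourhood of all of these.
  have hsub : ∀ᶠ q in 𝓝[P₀] q₀, S q ⊆ O := by
    by_contra hnot
    have hfreq : ∃ᶠ q in 𝓝[P₀] q₀, ∃ z, z ∈ S q ∧ z ∉ O := by
      refine (not_eventually.1 hnot).mono fun q hq => Set.not_subset.1 hq
    have hne : (comap Prod.fst (𝓝[P₀] q₀) ⊓ 𝓟 {p : P × W | p.2 ∈ S p.1 ∧ p.2 ∉ O}).NeBot := by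
      rw [← frequently_mem_iff_neBot, frequently_comap]
      exact hfreq.mono fun q ⟨z, hz⟩ => ⟨(q, z), rfl, hz⟩
    let 𝒰 := Ultrafilter.of (comap Prod.fst (𝓝[P₀] q₀) ⊓
      𝓟 {p : P × W | p.2 ∈ S p.1 ∧ p.2 ∉ O})
    have h𝒰 : (𝒰 : Filter (P × W)) ≤ _ := Ultrafilter.of_le _
    have hev : ∀ᶠ p in (𝒰 : Filter (P × W)), p.2 ∈ S p.1 ∧ p.2 ∉ O :=
      (h𝒰.trans inf_le_right) (mem_principal_self _)
    obtain ⟨z, hz, hlim⟩ := hproper 𝒰 (tendsto_iff_comap.2 (h𝒰.trans inf_le_left))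
      (hev.mono fun p hp => hp.1)
    obtain ⟨p, hp1, hp2⟩ := (hev.and (hlim (hO z hz))).exists
    exact hp1.2 hp2
  have h1 : ∀ᶠ q in 𝓝[P₀] q₀, ∀ z ∈ S q₀, ∀ w ∈ B z, w ∈ S q ↔ ψ z q = w :=
    nhdsWithin_le_nhds ((eventually_all_finite hfin).2 hBiff)
  have h2 : ∀ᶠ q in 𝓝[P₀] q₀, ∀ z ∈ S q₀, ψ z q ∈ B z ∩ N z :=
    nhdsWithin_le_nhds ((eventually_all_finite hfin).2 fun z hz =>
      (hψ z hz) (inter_mem (hB z hz) ((hN z).2.mem_nhds (hN z).1)))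
  filter_upwards [hsub, h1, h2] with q hqO hq1 hq2
  have hinj : Set.InjOn (fun z => ψ z q) (S q₀) := by
    intro z hz z' hz' h
    by_contra hne
    refine Set.disjoint_left.1 (hdisj hz hz' hne) (hq2 z hz).2 ?_
    have h' : ψ z q = ψ z' q := h
    rw [h']
    exact (hq2 z' hz').2
  have himg : (fun z => ψ z q) '' S q₀ = S q := by
    ext w
    constructor
    · rintro ⟨z, hz, rfl⟩
      exact (hq1 z hz _ (hq2 z hz).1).2 rfl
    · intro hw
      obtain ⟨z, hz, hwz⟩ := Set.mem_iUnion₂.1 (hqO hw)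
      exact ⟨z, hz, (hq1 z hz w hwz.1).1 hw⟩
  change (S q).encard = (S q₀).encard
  rw [← himg, hinj.encard_image]

end

/-! ### The equations in weak form -/

section

variable {V : Type*} {E : Type*} [Fintype E] (s t : E → V)

/-- The left hand side `∑_u g_u ∑_v q_{uv} / (z_u - z_v)` of the equations, tested against `g`. -/
def fluxAgainst (q : E → ℂ) (z g : V → ℂ) : ℂ :=
  ∑ e, q e * ((g (s e) - g (t e)) / (z (s e) - z (t e)))

/-- The sum `∑_u g_u ∑_v q_{uv}`. -/
def chargeAgainst (q : E → ℂ) (g : V → ℂ) : ℂ :=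
  ∑ e, q e * (g (s e) + g (t e))

section Decidable

variable [DecidableEq V]

/-- The sum `∑_v q_{uv} / (z_u - z_v)`. -/
def flux (q : E → ℂ) (z : V → ℂ) (u : V) : ℂ := fluxAgainst s t q z (Pi.single u 1)

/-- The sum `∑_v q_{uv}`. -/
def charge (q : E → ℂ) (u : V) : ℂ := chargeAgainst s t q (Pi.single u 1)

variable [Fintype V]

/-- Summation by parts: the two directions of an edge have opposite denominators, so together they
contribute `q (g_s - g_t) / (z_s - z_t)`. For charges they contribute `q (g_s + g_t)`. -/
lemma fluxAgainst_eq_sum (q : E → ℂ) (z g : V → ℂ) :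
    fluxAgainst s t q z g = ∑ u, g u * flux s t q z u := by
  simp only [flux, fluxAgainst, Finset.mul_sum]
  rw [Finset.sum_comm]
  refine Finset.sum_congr rfl fun e _ => ?_
  have h : ∀ v, g v = ∑ u, g u * (Pi.single u 1 : V → ℂ) v := by
    intro v
    simp [Pi.single_apply]
  conv_lhs => rw [h (s e), h (t e), ← Finset.sum_sub_distrib, Finset.sum_div, Finset.mul_sum]
  refine Finset.sum_congr rfl fun u _ => ?_
  ring

lemma chargeAgainst_eq_sum (q : E → ℂ) (g : V → ℂ) :
    chargeAgainst s t q g = ∑ u, g u * charge s t q u := by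
  simp only [charge, chargeAgainst, Finset.mul_sum]
  rw [Finset.sum_comm]
  refine Finset.sum_congr rfl fun e _ => ?_
  have h : ∀ v, g v = ∑ u, g u * (Pi.single u 1 : V → ℂ) v := by
    intro v
    simp [Pi.single_apply]
  conv_lhs => rw [h (s e), h (t e), ← Finset.sum_add_distrib, Finset.mul_sum]
  refine Finset.sum_congr rfl fun u _ => ?_
  ring

end Decidable

/-- The function obtained from `q` by deleting the edges that meet `S`. -/
def mask {V E : Type*} (s t : E → V) (S : Set V) (q : E → ℂ) : E → ℂ :=
  open Classical in fun e => if s e ∈ S ∨ t e ∈ S then 0 else q e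

lemma mask_empty {V E : Type*} (s t : E → V) (q : E → ℂ) : mask s t ∅ q = q := by
  ext e
  simp [mask]

/-! ### Limits along ultrafilters -/

section Limits

variable {X : Type*} {𝒰 : Ultrafilter X}

/-- Closed balls of `ℂ` are compact, so along an ultrafilter each coordinate converges or escapes,
without passage to subsequences. -/
lemma tendsto_cobounded_or_exists_tendsto (f : X → ℂ) :
    Tendsto f 𝒰 (Bornology.cobounded ℂ) ∨ ∃ a, Tendsto f 𝒰 (𝓝 a) := by
  by_cases h : Tendsto (fun x => ‖f x‖) 𝒰 atTop
  · exact Or.inl (tendsto_norm_atTop_iff_cobounded.1 h)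
  · right
    rw [tendsto_atTop] at h
    push Not at h
    obtain ⟨C, hC⟩ := h
    have hmem : (𝒰.map f : Filter ℂ) ≤ 𝓟 (Metric.closedBall 0 C) := by
      rw [le_principal_iff, Ultrafilter.coe_map, mem_map]
      refine hC.mono fun x hx => ?_
      simpa using hx.le
    obtain ⟨a, -, ha⟩ := (isCompact_closedBall (0 : ℂ) C).ultrafilter_le_nhds _ hmem
    exact ⟨a, ha⟩

variable {l : Filter X}

lemma tendsto_cobounded_sub {f g : X → ℂ} {a : ℂ} (hf : Tendsto f l (Bornology.cobounded ℂ))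
    (hg : Tendsto g l (𝓝 a)) : Tendsto (fun x => f x - g x) l (Bornology.cobounded ℂ) := by
  rw [← tendsto_norm_atTop_iff_cobounded] at hf ⊢
  have h : Tendsto (fun x => ‖f x‖ + -‖g x‖) l atTop := hf.atTop_add hg.norm.neg
  refine tendsto_atTop_mono (fun x => ?_) h
  simpa [sub_eq_add_neg] using norm_sub_norm_le (f x) (g x)

lemma tendsto_div_cobounded {f g : X → ℂ} {a : ℂ} (hf : Tendsto f l (𝓝 a))
    (hg : Tendsto g l (Bornology.cobounded ℂ)) : Tendsto (fun x => f x / g x) l (𝓝 0) := by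
  have := hf.mul (tendsto_inv₀_cobounded.comp hg)
  simpa [div_eq_mul_inv] using this

lemma eventually_ne_zero_of_cobounded {f : X → ℂ}
    (hf : Tendsto f l (Bornology.cobounded ℂ)) : ∀ᶠ x in l, f x ≠ 0 := by
  rw [← tendsto_norm_atTop_iff_cobounded] at hf
  exact (hf.eventually_gt_atTop 0).mono fun x hx => norm_pos_iff.1 hx

lemma exists_eventually_norm_le_of_tendsto_div {f g : X → ℂ} {a : ℂ} (hg : ∀ᶠ x in l, g x ≠ 0)
    (h : Tendsto (fun x => f x / g x) l (𝓝 a)) : ∃ C, ∀ᶠ x in l, ‖f x‖ ≤ C * ‖g x‖ := by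
  refine ⟨‖a‖ + 1, ?_⟩
  filter_upwards [hg, h.norm.eventually_le_const (lt_add_one ‖a‖)] with x hx hle
  rwa [norm_div, div_le_iff₀ (norm_pos_iff.2 hx)] at hle

/-- The approximate weak form of the equations along an ultrafilter: test functions that vanish on
the boundary, agree at `x` and `y` when `z` does, and do not vary much more quickly than `z`
between `x` and `y` yield identities in the limit. -/
def AsympSolution (B : Set V) (x y : V) (𝒰 : Ultrafilter X) (q : X → E → ℂ) (z : X → V → ℂ) :
    Prop :=
  ∀ g h : X → V → ℂ, (∀ i, ∀ v ∈ B, g i v = 0 ∧ h i v = 0) →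
    (∀ᶠ i in (𝒰 : Filter X), z i x = z i y → g i x = g i y ∧ h i x = h i y) →
    (∃ C, ∀ᶠ i in (𝒰 : Filter X),
      ‖(g i x - g i y) - (h i x + h i y) * (z i x - z i y)‖ ≤ C * ‖z i x - z i y‖) →
    Tendsto (fun i => fluxAgainst s t (q i) (z i) (g i) - chargeAgainst s t (q i) (h i)) 𝒰 (𝓝 0)

variable {s t}

open Classical in
/-- Along a family of solutions that collapses an edge, the values of `q` on the edges inside some
collapsing set of vertices sum to zero in the limit. -/
lemma AsympSolution.exists_cluster {B : Set V} {x y : V} {q : X → E → ℂ} {z : X → V → ℂ}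
    (H : AsympSolution s t B x y 𝒰 q z) {q₀ : E → ℂ} (hq : ∀ e, Tendsto (q · e) 𝒰 (𝓝 (q₀ e)))
    (hz : ∀ᶠ i in (𝒰 : Filter X), ∀ e, z i (s e) ≠ z i (t e)) {b : V → ℂ} (hb : Set.InjOn b B)
    (hzB : ∀ᶠ i in (𝒰 : Filter X), ∀ v ∈ B, z i v = b v) {e₀ : E}
    (he₀ : Tendsto (fun i => z i (s e₀) - z i (t e₀)) 𝒰 (𝓝 0)) :
    ∃ S : Set V, (B ∩ S).Subsingleton ∧ s e₀ ∈ S ∧ t e₀ ∈ S ∧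
      ∑ e, (if s e ∈ S ∧ t e ∈ S then q₀ e else 0) = 0 := by
  set u := t e₀ with hu
  set δ : X → ℂ := fun i => z i (s e₀) - z i u with hδ
  have hδ0 : ∀ᶠ i in (𝒰 : Filter X), δ i ≠ 0 := hz.mono fun i hi => sub_ne_zero.2 (hi e₀)
  -- The cluster consists of the vertices whose distance from `u` is at most of the order of `δ`.
  -- Distances within it are `O(δ)`; distances from it to other vertices dominate `δ`.
  let S : Set V := {w | ∃ a, Tendsto (fun i => (z i w - z i u) / δ i) 𝒰 (𝓝 a)}
  have hS : ∀ w w', w ∈ S → w' ∈ S →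
      ∃ a, Tendsto (fun i => (z i w - z i w') / δ i) 𝒰 (𝓝 a) := by
    rintro w w' ⟨a, ha⟩ ⟨a', ha'⟩
    refine ⟨a - a', (ha.sub ha').congr fun i => ?_⟩
    ring
  have hS' : ∀ w w', w ∈ S → w' ∉ S →
      Tendsto (fun i => (z i w' - z i w) / δ i) 𝒰 (Bornology.cobounded ℂ) := by
    rintro w w' ⟨a, ha⟩ hw'
    have h := (tendsto_cobounded_or_exists_tendsto (𝒰 := 𝒰)
      fun i => (z i w' - z i u) / δ i).resolve_right hw'
    refine (tendsto_cobounded_sub h ha).congr fun i => ?_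
    ring
  have hsub : (B ∩ S).Subsingleton := by
    rintro w ⟨hwB, hw⟩ w' ⟨hwB', hw'⟩
    apply hb hwB hwB'
    obtain ⟨a, ha⟩ := hS w w' hw hw'
    have h0 := ha.mul he₀
    rw [mul_zero] at h0
    have h1 : Tendsto (fun _ : X => b w - b w') 𝒰 (𝓝 0) := by
      refine h0.congr' ((hδ0.and hzB).mono fun i hi => ?_)
      change (z i w - z i w') / δ i * δ i = b w - b w'
      rw [div_mul_cancel₀ _ hi.1, hi.2 w hwB, hi.2 w' hwB']
    exact sub_eq_zero.1 (tendsto_nhds_unique tendsto_const_nhds h1)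
  have huS : u ∈ S := ⟨0, by simp⟩
  have hsS : s e₀ ∈ S := ⟨1, tendsto_const_nhds.congr' (hδ0.mono fun i hi => (div_self hi).symm)⟩
  -- Centring at the boundary vertex of the cluster, if there is one, makes the test function vanish
  -- on `B`. Its difference quotient is `1` on edges inside `S` and tends to `0` on all others.
  obtain ⟨c, hcS, hcB⟩ : ∃ c ∈ S, ∀ v ∈ B ∩ S, v = c := by
    rcases (B ∩ S).eq_empty_or_nonempty with h | ⟨c, hc⟩
    · exact ⟨u, huS, by simp [h]⟩
    · exact ⟨c, hc.2, fun v hv => hsub hv hc⟩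
  let g : X → V → ℂ := fun i w => if w ∈ S then z i w - z i c else 0
  have hout : ∀ w w', w ∈ S → w' ∉ S →
      Tendsto (fun i => (z i w - z i c) / (z i w' - z i w)) 𝒰 (𝓝 0) := by
    intro w w' hw hw'
    obtain ⟨a, ha⟩ := hS w c hw hcS
    refine (tendsto_div_cobounded ha (hS' w w' hw hw')).congr' (hδ0.mono fun i hi => ?_)
    exact div_div_div_cancel_right₀ hi _ _
  have hne : ∀ w w', w ∈ S → w' ∉ S → ∀ᶠ i in (𝒰 : Filter X), z i w' - z i w ≠ 0 :=
    fun w w' hw hw' => (eventually_ne_zero_of_cobounded (hS' w w' hw hw')).mono fun i hi h0 =>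
      hi (by rw [h0, zero_div])
  have hbound : ∀ w w', ∃ C, ∀ᶠ i in (𝒰 : Filter X), ‖g i w - g i w'‖ ≤ C * ‖z i w - z i w'‖ := by
    intro w w'
    by_cases hw : w ∈ S <;> by_cases hw' : w' ∈ S
    · exact ⟨1, Eventually.of_forall fun i => by simp [g, hw, hw']⟩
    · obtain ⟨C, hC⟩ := exists_eventually_norm_le_of_tendsto_div (hne w w' hw hw')
        (hout w w' hw hw')
      refine ⟨C, hC.mono fun i hi => ?_⟩
      rw [norm_sub_rev (z i w)]
      simpa [g, hw, hw'] using hi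
    · obtain ⟨C, hC⟩ := exists_eventually_norm_le_of_tendsto_div (hne w' w hw' hw)
        (hout w' w hw' hw)
      refine ⟨C, hC.mono fun i hi => ?_⟩
      rw [norm_sub_rev (g i w)]
      simpa [g, hw, hw'] using hi
    · exact ⟨0, Eventually.of_forall fun i => by simp [g, hw, hw']⟩
  refine ⟨S, hsub, hsS, huS, ?_⟩
  have hmerge : ∀ᶠ i in (𝒰 : Filter X), z i x = z i y → g i x = g i y ∧ (0 : ℂ) = 0 := by
    by_cases hx : x ∈ S <;> by_cases hy : y ∈ S
    · exact Eventually.of_forall fun i hi => by simp [g, hx, hy, hi]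
    · exact (hne x y hx hy).mono fun i hi h => absurd (sub_eq_zero.2 h.symm) hi
    · exact (hne y x hy hx).mono fun i hi h => absurd (sub_eq_zero.2 h) hi
    · exact Eventually.of_forall fun i hi => by simp [g, hx, hy]
  have hlim := H g 0 (fun i v hv => ⟨?_, rfl⟩) hmerge (by simpa using hbound x y)
  · refine tendsto_nhds_unique (tendsto_finsetSum _ fun e _ => ?_)
      (hlim.congr fun i => by simp [chargeAgainst]; rfl)
    have hcase : Tendsto (fun i => (g i (s e) - g i (t e)) / (z i (s e) - z i (t e))) 𝒰
        (𝓝 (if s e ∈ S ∧ t e ∈ S then 1 else 0)) := by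
      by_cases hs : s e ∈ S <;> by_cases ht : t e ∈ S
      · simp only [hs, ht, and_self, if_true, g]
        refine tendsto_const_nhds.congr' (hz.mono fun i hi => ?_)
        simp only [sub_sub_sub_cancel_right, div_self (sub_ne_zero.2 (hi e))]
      · simp only [hs, ht, and_false, if_true, if_false, g, sub_zero]
        refine (neg_zero (G := ℂ) ▸ (hout _ _ hs ht).neg).congr fun i => ?_
        rw [← div_neg, neg_sub]
      · simp only [hs, ht, false_and, if_true, if_false, g, zero_sub]
        refine (neg_zero (G := ℂ) ▸ (hout _ _ ht hs).neg).congr fun i => ?_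
        rw [neg_div]
      · simp [g, hs, ht]
    simpa using (hq e).mul hcase
  · by_cases hvS : v ∈ S
    · simp [g, hcB v ⟨hv, hvS⟩]
    · simp [g, hvS]

open Classical in
/-- Along a family of solutions with vertices that escape to infinity, a linear relation holds in
the limit between the positions of the neighbours of these vertices. -/
lemma AsympSolution.escape_relation {B : Set V} {x y : V} {q : X → E → ℂ} {z : X → V → ℂ}
    (H : AsympSolution s t B x y 𝒰 q z) {q₀ : E → ℂ} (hq : ∀ e, Tendsto (q · e) 𝒰 (𝓝 (q₀ e)))
    (hz : ∀ᶠ i in (𝒰 : Filter X), ∀ e, z i (s e) ≠ z i (t e)) {S : Set V} (hSB : ∀ v ∈ B, v ∉ S)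
    (hS : ∀ v ∈ S, Tendsto (z · v) 𝒰 (Bornology.cobounded ℂ)) {z₀ : V → ℂ}
    (hS₀ : ∀ v ∈ S, z₀ v = 0) (hS' : ∀ v ∉ S, Tendsto (z · v) 𝒰 (𝓝 (z₀ v))) :
    ∑ e, q₀ e * ((if s e ∈ S then z₀ (t e) else 0) + (if t e ∈ S then z₀ (s e) else 0)) = 0 := by
  -- On an edge inside `S`, `(z_u² - z_v²) / (z_u - z_v)` cancels the charge term `z_u + z_v`. On an
  -- edge from `u ∈ S` to `v ∉ S` there remains `z_u² / (z_u - z_v) - z_u = z_u z_v / (z_u - z_v)`,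
  -- which tends to the limit of `z_v`.
  let g : X → V → ℂ := fun i w => if w ∈ S then z i w ^ 2 else 0
  let h : X → V → ℂ := fun i w => if w ∈ S then z i w else 0
  have hne : ∀ w w', w ∈ S → w' ∉ S → ∀ᶠ i in (𝒰 : Filter X), z i w - z i w' ≠ 0 :=
    fun w w' hw hw' => eventually_ne_zero_of_cobounded (tendsto_cobounded_sub (hS w hw) (hS' w' hw'))
  have hquot : ∀ w w', w ∈ S → w' ∉ S →
      Tendsto (fun i => z i w * z i w' / (z i w - z i w')) 𝒰 (𝓝 (z₀ w')) := by
    intro w w' hw hw'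
    have h1 := hS' w' hw'
    have h2 := h1.add
      (tendsto_div_cobounded (h1.pow 2) (tendsto_cobounded_sub (hS w hw) (hS' w' hw')))
    rw [add_zero] at h2
    refine h2.congr' ((hne w w' hw hw').mono fun i hi => ?_)
    field_simp
    ring
  have hratio : ∀ w w', (∀ᶠ i in (𝒰 : Filter X), z i w ≠ z i w') →
      Tendsto (fun i => ((g i w - g i w') - (h i w + h i w') * (z i w - z i w')) /
        (z i w - z i w')) 𝒰
        (𝓝 ((if w ∈ S then z₀ w' else 0) + (if w' ∈ S then z₀ w else 0))) := by
    intro w w' hww'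
    by_cases hw : w ∈ S <;> by_cases hw' : w' ∈ S
    · simp only [g, h, hw, hw', if_true, hS₀ w hw, hS₀ w' hw', add_zero]
      refine tendsto_const_nhds.congr fun i => ?_
      ring
    · simp only [g, h, hw, hw', if_true, if_false, add_zero, sub_zero]
      refine (hquot w w' hw hw').congr fun i => ?_
      congr 1
      ring
    · simp only [g, h, hw, hw', if_true, if_false, zero_add, zero_sub]
      refine (hquot w' w hw' hw).congr fun i => ?_
      rw [← neg_sub (z i w), div_neg, ← neg_div]
      congr 1
      ring
    · simp [g, h, hw, hw']
  have hbound : ∃ C, ∀ᶠ i in (𝒰 : Filter X),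
      ‖(g i x - g i y) - (h i x + h i y) * (z i x - z i y)‖ ≤ C * ‖z i x - z i y‖ := by
    by_cases hxy : (x ∈ S ↔ y ∈ S)
    · refine ⟨0, Eventually.of_forall fun i => ?_⟩
      by_cases hx : x ∈ S
      · simp only [g, h, hx, hxy.1 hx, if_true]
        ring_nf
        simp
      · simp [g, h, hx, mt hxy.2 hx]
    · have hxy' : ∀ᶠ i in (𝒰 : Filter X), z i x - z i y ≠ 0 := by
        by_cases hx : x ∈ S
        · exact hne x y hx (fun hy => hxy ⟨fun _ => hy, fun _ => hx⟩)
        · have hy : y ∈ S := by tauto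
          exact (hne y x hy hx).mono fun i hi h0 => hi (by rw [← neg_sub, h0, neg_zero])
      exact exists_eventually_norm_le_of_tendsto_div hxy'
        (hratio x y (hxy'.mono fun i hi => sub_ne_zero.1 hi))
  have hmerge : ∀ᶠ i in (𝒰 : Filter X), z i x = z i y → g i x = g i y ∧ h i x = h i y := by
    by_cases hx : x ∈ S <;> by_cases hy : y ∈ S
    · exact Eventually.of_forall fun i hi => by simp [g, h, hx, hy, hi]
    · exact (hne x y hx hy).mono fun i hi h => absurd (sub_eq_zero.2 h) hi
    · exact (hne y x hy hx).mono fun i hi h => absurd (sub_eq_zero.2 h.symm) hi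
    · exact Eventually.of_forall fun i hi => by simp [g, h, hx, hy]
  have hlim := H g h (fun i v hv => by simp [g, h, hSB v hv]) hmerge hbound
  refine tendsto_nhds_unique (tendsto_finsetSum _ fun e _ => (hq e).mul
    (hratio (s e) (t e) (hz.mono fun i hi => hi e))) (hlim.congr' (hz.mono fun i hi => ?_))
  rw [fluxAgainst, chargeAgainst, ← Finset.sum_sub_distrib]
  refine Finset.sum_congr rfl fun e _ => ?_
  have := sub_ne_zero.2 (hi e)
  rw [sub_div (g i (s e) - g i (t e)), mul_div_cancel_right₀ _ this]
  ring

open Classical in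
/-- The flux at a vertex that stays bounded converges to the flux in the graph without the
escaping vertices. -/
lemma tendsto_flux [DecidableEq V] {q : X → E → ℂ} {z : X → V → ℂ} {q₀ : E → ℂ}
    (hq : ∀ e, Tendsto (q · e) 𝒰 (𝓝 (q₀ e))) {S : Set V}
    (hS : ∀ v ∈ S, Tendsto (z · v) 𝒰 (Bornology.cobounded ℂ)) {z₀ : V → ℂ}
    (hS' : ∀ v ∉ S, Tendsto (z · v) 𝒰 (𝓝 (z₀ v)))
    (hz₀ : ∀ e, s e ∉ S → t e ∉ S → z₀ (s e) ≠ z₀ (t e)) {u : V} (hu : u ∉ S) :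
    Tendsto (fun i => flux s t (q i) (z i) u) 𝒰
      (𝓝 (flux s t (mask s t S q₀) z₀ u)) := by
  refine tendsto_finsetSum _ fun e _ => ?_
  by_cases h0 : (Pi.single u 1 : V → ℂ) (s e) - (Pi.single u 1 : V → ℂ) (t e) = 0
  · simp [h0]
  by_cases hs : s e ∈ S <;> by_cases ht : t e ∈ S
  · have h1 : s e ≠ u := fun h => hu (h ▸ hs)
    have h2 : t e ≠ u := fun h => hu (h ▸ ht)
    exact absurd (by simp [h1, h2]) h0
  · simp only [mask, hs, true_or, if_true, zero_mul]
    have := (hq e).mul (tendsto_div_cobounded (l := (𝒰 : Filter X))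
      (a := (Pi.single u 1 : V → ℂ) (s e) - (Pi.single u 1 : V → ℂ) (t e)) tendsto_const_nhds
      (tendsto_cobounded_sub (hS _ hs) (hS' _ ht)))
    rw [mul_zero] at this
    exact this
  · simp only [mask, ht, or_true, if_true, zero_mul]
    have := (hq e).mul (tendsto_div_cobounded (l := (𝒰 : Filter X))
      (a := -((Pi.single u 1 : V → ℂ) (s e) - (Pi.single u 1 : V → ℂ) (t e))) tendsto_const_nhds
      (tendsto_cobounded_sub (hS _ ht) (hS' _ hs)))
    rw [mul_zero] at this
    refine this.congr fun i => ?_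
    rw [← neg_sub (z i (s e)), neg_div_neg_eq]
  · simp only [mask, hs, ht, or_self, if_false]
    exact (hq e).mul (tendsto_const_nhds.div ((hS' _ hs).sub (hS' _ ht))
      (sub_ne_zero.2 (hz₀ e hs ht)))

end Limits

end

section

variable {V : Type*} {E : Type*} [Fintype E] [DecidableEq V] {s t : E → V}

/-! ### Derivatives of the equations -/

variable (s t) in
/-- Minus the differential of `z ↦ flux s t q z u`. -/
def fluxDeriv (q : E → ℂ) (z : V → ℂ) (u : V) : (V → ℂ) →ₗ[ℂ] ℂ :=
  ∑ e, (q e * ((Pi.single u 1 : V → ℂ) (s e) - (Pi.single u 1 : V → ℂ) (t e)) /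
    (z (s e) - z (t e)) ^ 2) •
    ((LinearMap.proj (s e) : (V → ℂ) →ₗ[ℂ] ℂ) - LinearMap.proj (t e))

lemma fluxDeriv_apply (q : E → ℂ) (z : V → ℂ) (u : V) (ζ : V → ℂ) :
    fluxDeriv s t q z u ζ =
      ∑ e, q e * ((Pi.single u 1 : V → ℂ) (s e) - (Pi.single u 1 : V → ℂ) (t e)) /
        (z (s e) - z (t e)) ^ 2 * (ζ (s e) - ζ (t e)) := by
  simp [fluxDeriv]

lemma derivation_single {k : IntermediateField ℚ ℂ} (D : Derivation k ℂ ℂ) (u v : V) :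
    D ((Pi.single u 1 : V → ℂ) v) = 0 := by
  rw [Pi.single_apply]
  split_ifs <;> simp

/-- The chain rule. No separation of `z` is needed: an edge with `z_s = z_t` contributes zero to
every term, since division by zero gives zero. -/
lemma derivation_flux {k : IntermediateField ℚ ℂ} (D : Derivation k ℂ ℂ) (q : E → ℂ) (z : V → ℂ)
    (u : V) : D (flux s t q z u) =
      flux s t (fun e => D (q e)) z u - fluxDeriv s t q z u (fun v => D (z v)) := by
  rw [flux, flux, fluxAgainst, fluxAgainst, fluxDeriv_apply, map_sum, ← Finset.sum_sub_distrib]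
  refine Finset.sum_congr rfl fun e _ => ?_
  rw [Derivation.leibniz, Derivation.leibniz_div, map_sub, map_sub, derivation_single,
    derivation_single]
  simp only [smul_eq_mul]
  by_cases h : z (s e) - z (t e) = 0
  · simp [h]
  · field_simp
    ring

lemma hasDerivAt_flux (q : E → ℂ) {z : V → ℂ} (hz : ∀ e, z (s e) ≠ z (t e)) (ζ : V → ℂ) (u : V) :
    HasDerivAt (fun τ : ℂ => flux s t q (z + τ • ζ) u) (-fluxDeriv s t q z u ζ) 0 := by
  rw [fluxDeriv_apply, ← Finset.sum_neg_distrib]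
  refine HasDerivAt.fun_sum fun e _ => ?_
  have hv : ∀ v, HasDerivAt (fun τ : ℂ => (z + τ • ζ) v) (ζ v) 0 := by
    intro v
    simpa using ((hasDerivAt_id (0 : ℂ)).mul_const (ζ v)).const_add (z v)
  have hne : (z + (0 : ℂ) • ζ) (s e) - (z + (0 : ℂ) • ζ) (t e) ≠ 0 := by
    simpa using sub_ne_zero.2 (hz e)
  have h := ((hasDerivAt_const (0 : ℂ)
    ((Pi.single u 1 : V → ℂ) (s e) - (Pi.single u 1 : V → ℂ) (t e))).fun_div
    ((hv (s e)).sub (hv (t e))) hne).const_mul (q e)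
  refine h.congr_deriv ?_
  have := sub_ne_zero.2 (hz e)
  simp only [zero_smul, add_zero, Pi.sub_apply]
  field_simp
  ring

/-! ### The linear space of charge-free functions -/

variable (s t) in
/-- The real functions on the edges whose sum at every vertex outside `B` vanishes. -/
def chargeFree (B : Set V) : Submodule ℝ (E → ℝ) where
  carrier := {q | ∀ u ∉ B, charge s t (fun e => (q e : ℂ)) u = 0}
  add_mem' {q q'} h h' u hu := by
    have h1 := h u hu
    have h2 := h' u hu
    simp only [charge, chargeAgainst] at h1 h2 ⊢
    simp only [Pi.add_apply, Complex.ofReal_add, add_mul, Finset.sum_add_distrib, h1, h2, add_zero]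
  zero_mem' u hu := by simp [charge, chargeAgainst]
  smul_mem' c q h u hu := by
    have h1 := h u hu
    simp only [charge, chargeAgainst] at h1 ⊢
    simp only [Pi.smul_apply, smul_eq_mul, Complex.ofReal_mul, mul_assoc, ← Finset.mul_sum, h1,
      mul_zero]

/-- Every edge starts outside `B` and every vertex outside `B` is joined to every vertex of `B`. -/
structure JoinedToBoundary (s t : E → V) (B : Set V) : Prop where
  start_notMem : ∀ e, s e ∉ B
  exists_edge : ∀ u ∉ B, ∀ v ∈ B, ∃ e, s e = u ∧ t e = v

lemma charge_add (q q' : E → ℂ) (u : V) :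
    charge s t (fun e => q e + q' e) u = charge s t q u + charge s t q' u := by
  simp [charge, chargeAgainst, add_mul, Finset.sum_add_distrib]

lemma charge_sub (q q' : E → ℂ) (u : V) :
    charge s t (fun e => q e - q' e) u = charge s t q u - charge s t q' u := by
  simp [charge, chargeAgainst, sub_mul, Finset.sum_sub_distrib]

variable [DecidableEq E]

lemma charge_single (e : E) (c : ℝ) (u : V) :
    charge s t (fun e' => ((Pi.single e c : E → ℝ) e' : ℂ)) u =
      c * ((Pi.single u 1 : V → ℂ) (s e) + (Pi.single u 1 : V → ℂ) (t e)) := by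
  rw [charge, chargeAgainst, Finset.sum_eq_single e]
  · simp
  · intro e' _ h
    simp [h]
  · simp

variable {B : Set V}

/-- Moving weight between two edges from the same vertex to the boundary changes no interior charge.
These directions vary the equation at one vertex alone. -/
lemma single_sub_single_mem_chargeFree {e₁ e₂ : E} (hs : s e₁ = s e₂) (h₁ : t e₁ ∈ B)
    (h₂ : t e₂ ∈ B) : (Pi.single e₁ 1 - Pi.single e₂ 1 : E → ℝ) ∈ chargeFree s t B := by
  intro u hu
  have h1 : t e₁ ≠ u := fun h => hu (h ▸ h₁)
  have h2 : t e₂ ≠ u := fun h => hu (h ▸ h₂)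
  simp only [Pi.sub_apply, Complex.ofReal_sub]
  rw [charge_sub, charge_single, charge_single]
  simp [h1, h2, hs]

open Classical in
/-- For generic `q`, the sum of `q` over the edges inside a set of vertices with at most one
boundary vertex is not zero, unless there are no such edges. -/
lemma GenericIn.sum_inside_ne_zero {k : IntermediateField ℚ ℂ} {q : E → ℝ}
    (hq : GenericIn k (chargeFree s t B) q) (hJ : JoinedToBoundary s t B)
    (hB : B.Nontrivial) {S : Set V} (hS : (B ∩ S).Subsingleton) {e₀ : E} (hs : s e₀ ∈ S)
    (ht : t e₀ ∈ S) : ∑ e, (if s e ∈ S ∧ t e ∈ S then (q e : ℂ) else 0) ≠ 0 := by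
  intro h0
  obtain ⟨v, hvB, hvS⟩ : ∃ v ∈ B, v ∉ S := by
    by_contra! h
    obtain ⟨v, hv, w, hw, hne⟩ := hB
    exact hne (hS ⟨hv, h v hv⟩ ⟨hw, h w hw⟩)
  obtain ⟨e₁, hs₁, ht₁⟩ := hJ.exists_edge (s e₀) (hJ.start_notMem e₀) v hvB
  have hpoly := hq.2 (∑ e, if s e ∈ S ∧ t e ∈ S then MvPolynomial.X e else 0) (by
    rw [map_sum]
    refine Eq.trans ?_ h0
    refine Finset.sum_congr rfl fun e _ => ?_
    split_ifs <;> simp)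
  have hin : ∀ e' (c : ℝ), ∑ e, (if s e ∈ S ∧ t e ∈ S then (((Pi.single e' c : E → ℝ) e : ℝ) : ℂ)
      else 0) = if s e' ∈ S ∧ t e' ∈ S then (c : ℂ) else 0 := by
    intro e' c
    rw [Finset.sum_eq_single e']
    · simp
    · intro e _ h
      simp [h]
    · simp
  have hval : ∀ q' ∈ chargeFree s t B,
      ∑ e, (if s e ∈ S ∧ t e ∈ S then (q' e : ℂ) else 0) = 0 := by
    intro q' hq'
    refine Eq.trans ?_ (hpoly q' hq')
    rw [map_sum]
    refine Finset.sum_congr rfl fun e _ => ?_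
    split_ifs <;> simp
  have hout₁ : ¬ (s e₁ ∈ S ∧ t e₁ ∈ S) := fun h => hvS (ht₁ ▸ h.2)
  -- Weight `1` on `e₀`, compensated on edges that join its interior ends to `v ∉ S`, is admissible
  -- and changes the sum inside `S` by `1`. So this linear form is not zero on the whole space.
  by_cases hB₀ : t e₀ ∈ B
  · have h := hval _ (single_sub_single_mem_chargeFree (s := s) (t := t) hs₁.symm hB₀
      (ht₁.symm ▸ hvB))
    have h' : ∑ e, ((if s e ∈ S ∧ t e ∈ S then (((Pi.single e₀ 1 : E → ℝ) e : ℝ) : ℂ) else 0) -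
        (if s e ∈ S ∧ t e ∈ S then (((Pi.single e₁ 1 : E → ℝ) e : ℝ) : ℂ) else 0)) = 0 := by
      refine Eq.trans ?_ h
      refine Finset.sum_congr rfl fun e _ => ?_
      split_ifs <;> simp
    rw [Finset.sum_sub_distrib, hin, hin, if_pos ⟨hs, ht⟩, if_neg hout₁] at h'
    simp at h'
  · obtain ⟨e₂, hs₂, ht₂⟩ := hJ.exists_edge (t e₀) hB₀ v hvB
    have hout₂ : ¬ (s e₂ ∈ S ∧ t e₂ ∈ S) := fun h => hvS (ht₂ ▸ h.2)
    have hmem : (Pi.single e₀ 1 - (Pi.single e₁ 1 + Pi.single e₂ 1) : E → ℝ) ∈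
        chargeFree s t B := by
      intro u hu
      have hvu : v ≠ u := fun h => hu (h ▸ hvB)
      simp only [Pi.sub_apply, Pi.add_apply, Complex.ofReal_sub, Complex.ofReal_add]
      rw [charge_sub, charge_add, charge_single, charge_single, charge_single, hs₁, ht₁, hs₂, ht₂]
      simp [hvu]
    have h := hval _ hmem
    have h' : ∑ e, ((if s e ∈ S ∧ t e ∈ S then (((Pi.single e₀ 1 : E → ℝ) e : ℝ) : ℂ) else 0) -
        ((if s e ∈ S ∧ t e ∈ S then (((Pi.single e₁ 1 : E → ℝ) e : ℝ) : ℂ) else 0) +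
        (if s e ∈ S ∧ t e ∈ S then (((Pi.single e₂ 1 : E → ℝ) e : ℝ) : ℂ) else 0))) = 0 := by
      refine Eq.trans ?_ h
      refine Finset.sum_congr rfl fun e _ => ?_
      split_ifs <;> simp
    rw [Finset.sum_sub_distrib, Finset.sum_add_distrib, hin, hin, hin, if_pos ⟨hs, ht⟩,
      if_neg hout₁, if_neg hout₂] at h'
    simp at h'

end

section

/-! ### Linear algebra -/

section LinearAlgebra

/-- Used to refute overdetermined systems: if the images under a square matrix of vectors in `N`
span everything, then `N` cannot be a proper subspace. -/
lemma eq_top_of_map_eq_top {V : Type*} [Finite V] {M : (V → ℂ) →ₗ[ℂ] (V → ℂ)} {N : Submodule ℂ (V → ℂ)}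
    (h : N.map M = ⊤) : N = ⊤ := by
  have hsurj : Function.Surjective M := by
    rw [← LinearMap.range_eq_top, eq_top_iff, ← h]
    exact LinearMap.map_le_range
  have hinj : Function.Injective M := LinearMap.injective_iff_surjective.2 hsurj
  apply Submodule.map_injective_of_injective hinj
  rw [h, Submodule.map_top, LinearMap.range_eq_top.2 hsurj]

variable {V : Type*} [Fintype V] [DecidableEq V]

/-- One step of elimination: all entries of `f` but one are already accounted for. -/
lemma single_mem_of_mem {R : Submodule ℂ (V → ℂ)} {f : V → ℂ} (hf : f ∈ R) {v : V} (hv : f v ≠ 0)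
    (h : ∀ w, w ≠ v → f w ≠ 0 → (Pi.single w 1 : V → ℂ) ∈ R) : (Pi.single v 1 : V → ℂ) ∈ R := by
  have hrest : ∑ w ∈ Finset.univ.erase v, f w • (Pi.single w 1 : V → ℂ) ∈ R := by
    refine R.sum_mem fun w hw => ?_
    by_cases h0 : f w = 0
    · simp [h0]
    · exact R.smul_mem _ (h w (Finset.ne_of_mem_erase hw) h0)
  have hsum : f = f v • (Pi.single v 1 : V → ℂ) +
      ∑ w ∈ Finset.univ.erase v, f w • (Pi.single w 1 : V → ℂ) := by
    rw [Finset.add_sum_erase _ (fun w => f w • (Pi.single w 1 : V → ℂ)) (Finset.mem_univ v)]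
    exact pi_eq_sum_univ' f
  have h1 : f v • (Pi.single v 1 : V → ℂ) ∈ R := by
    rw [eq_sub_of_add_eq hsum.symm]
    exact R.sub_mem hf hrest
  have := R.smul_mem (f v)⁻¹ h1
  rwa [smul_smul, inv_mul_cancel₀ hv, one_smul] at this

lemma eq_top_of_forall_single_mem {R : Submodule ℂ (V → ℂ)}
    (h : ∀ v, (Pi.single v 1 : V → ℂ) ∈ R) : R = ⊤ := by
  rw [eq_top_iff]
  intro f _
  rw [pi_eq_sum_univ' f]
  exact R.sum_mem fun v _ => R.smul_mem _ (h v)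

end LinearAlgebra

lemma derivation_mask {V E : Type*} {s t : E → V} {k : IntermediateField ℚ ℂ} (D : Derivation k ℂ ℂ) (S : Set V) (q : E → ℂ) :
    (fun e => D (mask s t S q e)) = mask s t S fun e => D (q e) := by
  ext e
  simp only [mask]
  split_ifs <;> simp

variable {V : Type*} {E : Type*} [Fintype E] [DecidableEq V] {s t : E → V} {B : Set V}

/-! ### Variations of generic functions -/

lemma flux_sub (q q' : E → ℂ) (z : V → ℂ) (u : V) :
    flux s t (fun e => q e - q' e) z u = flux s t q z u - flux s t q' z u := by
  simp [flux, fluxAgainst, sub_mul, Finset.sum_sub_distrib]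

section Variation

variable [DecidableEq E]

lemma flux_mask_single {S : Set V} (hSB : ∀ v ∈ B, v ∉ S) {e : E} (he : t e ∈ B) (z : V → ℂ)
    {w : V} (hw : w ∉ B) :
    flux s t (mask s t S (Pi.single e 1)) z w =
      open Classical in if w = s e ∧ s e ∉ S then (z (s e) - z (t e))⁻¹ else 0 := by
  have h1 : t e ≠ w := fun h => hw (h ▸ he)
  rw [flux, fluxAgainst, Finset.sum_eq_single e]
  · by_cases hS : s e ∈ S
    · simp [mask, hS]
    · by_cases hws : w = s e
      · subst hws
        simp [mask, hS, hSB _ he, h1]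
      · simp [mask, hws, h1, Ne.symm hws]
  · intro e' _ h
    simp [mask, h]
  · simp

open Classical in
/-- For generic `q` and an interior vertex `u`, some derivation of `ℂ` varies `q` only along two
edges from `u` to the boundary. -/
lemma GenericIn.exists_variation {k : IntermediateField ℚ ℂ} {q : E → ℝ}
    (hq : GenericIn k (chargeFree s t B) q) (hJ : JoinedToBoundary s t B) {v₁ v₂ : V}
    (h₁ : v₁ ∈ B) (h₂ : v₂ ∈ B) {u : V} (hu : u ∉ B) :
    ∃ D : Derivation k ℂ ℂ, ∀ S : Set V, (∀ v ∈ B, v ∉ S) → ∀ z : V → ℂ,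
      (∀ w ∉ B, flux s t (mask s t S fun e => D (q e)) z w =
        if w = u ∧ u ∉ S then (z u - z v₁)⁻¹ - (z u - z v₂)⁻¹ else 0) ∧
      ∑ e, D (q e) * ((if s e ∈ S then z (t e) else 0) + (if t e ∈ S then z (s e) else 0)) =
        if u ∈ S then z v₁ - z v₂ else 0 := by
  obtain ⟨e₁, hs₁, ht₁⟩ := hJ.exists_edge u hu v₁ h₁
  obtain ⟨e₂, hs₂, ht₂⟩ := hJ.exists_edge u hu v₂ h₂
  obtain ⟨D, hD⟩ := hq.exists_derivation (single_sub_single_mem_chargeFree (s := s) (t := t)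
    (hs₁.trans hs₂.symm) (ht₁.symm ▸ h₁) (ht₂.symm ▸ h₂))
  have hD' : ∀ e, D (q e) = (Pi.single e₁ 1 : E → ℂ) e - (Pi.single e₂ 1 : E → ℂ) e := by
    intro e
    rw [hD]
    simp only [Pi.sub_apply, Complex.ofReal_sub, Pi.single_apply]
    split_ifs <;> simp
  refine ⟨D, fun S hS z => ⟨fun w hw => ?_, ?_⟩⟩
  · have hmask : (mask s t S fun e => D (q e)) = fun e =>
        mask s t S (Pi.single e₁ 1) e - mask s t S (Pi.single e₂ 1) e := by
      ext e
      simp only [mask, hD']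
      split_ifs <;> simp
    rw [hmask, flux_sub, flux_mask_single hS (ht₁.symm ▸ h₁) z hw,
      flux_mask_single hS (ht₂.symm ▸ h₂) z hw, hs₁, hs₂, ht₁, ht₂]
    split_ifs <;> simp
  · simp only [hD', sub_mul, Finset.sum_sub_distrib, Pi.single_apply, ite_mul, one_mul, zero_mul,
      Finset.sum_ite_eq', Finset.mem_univ, if_true, hs₁, hs₂, ht₁, ht₂, hS v₁ h₁, hS v₂ h₂, if_false,
      add_zero]
    split_ifs <;> simp

end Variation

variable [Fintype V]

open Classical in
/-- For generic `q`, a partial solution on the complement of `S`, possibly with two vertices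
merged, does not satisfy the relation forced by the escape of the vertices of `S` to infinity. -/
lemma GenericIn.not_escape_relation {k : IntermediateField ℚ ℂ} {q : E → ℝ}
    (hq : GenericIn k (chargeFree s t B) q) (hJ : JoinedToBoundary s t B) (hB : B.Nontrivial)
    {b : V → ℂ} (hb : Set.InjOn b B) (hbk : ∀ v ∈ B, b v ∈ k) {S : Set V} (hS : S.Nonempty)
    (hSB : ∀ v ∈ B, v ∉ S) {z : V → ℂ} (hzB : ∀ v ∈ B, z v = b v) (hzS : ∀ v ∈ S, z v = 0)
    {x y : V} (hx : x ∉ B) (hy : y ∉ B)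
    (hxy : x ≠ y) (m : Prop) (hm : m → x ∉ S ∧ y ∉ S ∧ z x = z y ∧
      flux s t (mask s t S fun e => (q e : ℂ)) z x + flux s t (mask s t S fun e => (q e : ℂ)) z y = 0)
    (hflux : ∀ u ∉ B, u ∉ S → ¬ (m ∧ (u = x ∨ u = y)) →
      flux s t (mask s t S fun e => (q e : ℂ)) z u = 0) :
    ∑ e, (q e : ℂ) * ((if s e ∈ S then z (t e) else 0) + (if t e ∈ S then z (s e) else 0)) ≠ 0 := by
  intro hesc
  obtain ⟨u₀, hu₀⟩ := hS
  have hu₀B : u₀ ∉ B := fun h => hSB _ h hu₀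
  obtain ⟨v₁, h₁, v₂, h₂, hv⟩ := hB
  set Q : E → ℂ := mask s t S fun e => (q e : ℂ) with hQ
  choose! D hD using fun u (hu : u ∉ B) => hq.exists_variation hJ h₁ h₂ hu
  let esc : (V → ℂ) →ₗ[ℂ] ℂ := ∑ e, (q e : ℂ) •
    ((if s e ∈ S then (LinearMap.proj (t e) : (V → ℂ) →ₗ[ℂ] ℂ) else 0) +
      (if t e ∈ S then (LinearMap.proj (s e) : (V → ℂ) →ₗ[ℂ] ℂ) else 0))
  have hesc_apply : ∀ ζ, esc ζ = ∑ e, (q e : ℂ) *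
      ((if s e ∈ S then ζ (t e) else 0) + (if t e ∈ S then ζ (s e) else 0)) := by
    intro ζ
    simp only [esc, LinearMap.sum_apply, LinearMap.smul_apply, LinearMap.add_apply, smul_eq_mul]
    refine Finset.sum_congr rfl fun e _ => ?_
    split_ifs <;> simp
  -- A square matrix: the values on `B` and on `S \ {u₀}` are frozen, the escape relation takes the
  -- place of the equation at `u₀`, and for merged `x`, `y` there are the summed equation and `ζ_x =
  -- ζ_y`. The additional condition `ζ_{u₀} = 0`, which defines `N`, makes the system
  -- overdetermined.
  let row : V → (V → ℂ) →ₗ[ℂ] ℂ := fun v =>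
    if v ∈ B ∨ (v ∈ S ∧ v ≠ u₀) then LinearMap.proj v
    else if v = u₀ then esc
    else if m ∧ v = x then fluxDeriv s t Q z x + fluxDeriv s t Q z y
    else if m ∧ v = y then (LinearMap.proj x : (V → ℂ) →ₗ[ℂ] ℂ) - LinearMap.proj y
    else fluxDeriv s t Q z v
  let M : (V → ℂ) →ₗ[ℂ] (V → ℂ) := LinearMap.pi row
  let N : Submodule ℂ (V → ℂ) := LinearMap.ker (LinearMap.proj u₀ : (V → ℂ) →ₗ[ℂ] ℂ)
  have hzne : ∀ u ∉ B, u ∉ S → (z u - z v₁)⁻¹ - (z u - z v₂)⁻¹ ≠ 0 := by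
    intro u hu huS h
    -- Inversion is injective on `ℂ` also with `0⁻¹ = 0`, so `z u` need not avoid the boundary
    -- values.
    rw [sub_eq_zero, inv_inj, sub_right_inj, hzB _ h₁, hzB _ h₂] at h
    exact hv (hb h₁ h₂ h)
  have hDz : ∀ u ∉ B, ∀ v, v ∈ B ∨ v ∈ S → D u (z v) = 0 := by
    rintro u - v (hv | hv)
    · rw [hzB v hv]
      exact (D u).map_algebraMap ⟨b v, hbk v hv⟩
    · rw [hzS v hv, map_zero]
  have hfd : ∀ u ∉ B, ∀ w ∉ B, ∀ c, c = flux s t Q z w → fluxDeriv s t Q z w (fun v => D u (z v)) =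
      (if w = u ∧ u ∉ S then (z u - z v₁)⁻¹ - (z u - z v₂)⁻¹ else 0) - D u c := by
    rintro u hu w hw _ rfl
    rw [derivation_flux, hQ, derivation_mask, ((hD u hu S hSB z).1 w hw)]
    ring
  -- Differentiating the identities satisfied by `z` along `D u` leaves only the effect of moving
  -- weight between two boundary edges at `u`. It appears in the row of `u`, or in the summed row
  -- `x` if `u` is merged; for `u ∈ S` it appears in the escape row.
  have hMD : ∀ u ∉ B, ∀ w, M (fun v => D u (z v)) w =
      if w ∈ B ∨ (w ∈ S ∧ w ≠ u₀) then 0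
      else if w = u₀ then (if u ∈ S then -(z v₁ - z v₂) else 0)
      else if m ∧ w = x then (if (u = x ∨ u = y) then (z u - z v₁)⁻¹ - (z u - z v₂)⁻¹ else 0)
      else if m ∧ w = y then 0
      else if w = u ∧ u ∉ S then (z u - z v₁)⁻¹ - (z u - z v₂)⁻¹ else 0 := by
    intro u hu w
    simp only [M, LinearMap.pi_apply, row]
    by_cases hw1 : w ∈ B ∨ (w ∈ S ∧ w ≠ u₀)
    · simp only [hw1, if_true, LinearMap.proj_apply]
      exact hDz u hu w (hw1.imp id And.left)
    simp only [hw1, if_false]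
    by_cases hw2 : w = u₀
    · simp only [hw2, if_true]
      have h := congrArg (D u) hesc
      rw [map_zero, map_sum] at h
      have h' : ∑ e, D u ((q e : ℂ) * ((if s e ∈ S then z (t e) else 0) +
          (if t e ∈ S then z (s e) else 0))) = esc (fun v => D u (z v)) +
          ∑ e, D u (q e) * ((if s e ∈ S then z (t e) else 0) + (if t e ∈ S then z (s e) else 0)) := by
        rw [hesc_apply, ← Finset.sum_add_distrib]
        refine Finset.sum_congr rfl fun e _ => ?_
        rw [Derivation.leibniz]
        simp only [smul_eq_mul, map_add, apply_ite (D u), map_zero]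
        ring
      rw [h', (hD u hu S hSB z).2] at h
      rw [eq_neg_of_add_eq_zero_left h]
      split_ifs <;> simp
    simp only [hw2, if_false]
    have hwB : w ∉ B := fun h => hw1 (Or.inl h)
    have hwS : w ∉ S := fun h => hw1 (Or.inr ⟨h, hw2⟩)
    by_cases hw3 : m ∧ w = x
    · obtain ⟨hxS, hyS, hzxy, hsum⟩ := hm hw3.1
      simp only [hw3.1, hw3.2, true_and, if_true, LinearMap.add_apply]
      have h := congrArg (D u) hsum
      rw [map_add, map_zero] at h
      rw [hfd u hu x hx _ rfl, hfd u hu y hy _ rfl, sub_add_sub_comm, h, sub_zero]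
      by_cases hux : u = x
      · subst hux
        simp [hxS, hxy.symm]
      · by_cases huy : u = y
        · subst huy
          simp [hyS, hxy]
        · simp [Ne.symm hux, Ne.symm huy, hux, huy]
    simp only [hw3, if_false]
    by_cases hw4 : m ∧ w = y
    · obtain ⟨hxS, hyS, hzxy, hsum⟩ := hm hw4.1
      simp only [hw4.1, hw4.2, true_and, if_true, LinearMap.sub_apply, LinearMap.proj_apply, hzxy,
        sub_self]
    simp only [hw4, if_false]
    rw [hfd u hu w hwB 0 (hflux w hwB hwS (by tauto)).symm, map_zero, sub_zero]
  have hDN : ∀ u ∉ B, (fun v => D u (z v)) ∈ N := fun u hu =>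
    (LinearMap.mem_ker).2 (hDz u hu u₀ (Or.inr hu₀))
  have hzero : ∀ v, ∀ w, (w ∈ B ∨ (w ∈ S ∧ w ≠ u₀)) → w ≠ v → M (Pi.single v 1) w = 0 := by
    intro v w hw hwv
    simp only [M, LinearMap.pi_apply, row, hw, if_true, LinearMap.proj_apply]
    simp [hwv]
  have hsingle : ∀ v, v ≠ u₀ → M (Pi.single v 1) ∈ N.map M := fun v hv =>
    Submodule.mem_map_of_mem (LinearMap.mem_ker.2 (by simp [hv.symm]))
  have g0 : (Pi.single u₀ 1 : V → ℂ) ∈ N.map M := by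
    refine single_mem_of_mem (Submodule.mem_map_of_mem (hDN u₀ hu₀B)) ?_ ?_
    · rw [hMD u₀ hu₀B, if_neg (by simp [hu₀B]), if_pos rfl, if_pos hu₀, hzB _ h₁, hzB _ h₂]
      exact neg_ne_zero.2 (sub_ne_zero.2 fun h => hv (hb h₁ h₂ h))
    · intro w hw h
      exfalso
      apply h
      rw [hMD u₀ hu₀B]
      have : ¬ (m ∧ (u₀ = x ∨ u₀ = y)) := by
        rintro ⟨hm', rfl | rfl⟩
        · exact (hm hm').1 hu₀
        · exact (hm hm').2.1 hu₀
      by_cases hwB : w ∈ B ∨ (w ∈ S ∧ w ≠ u₀)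
      · rw [if_pos hwB]
      rw [if_neg hwB, if_neg hw]
      by_cases hwx : m ∧ w = x
      · rw [if_pos hwx, if_neg fun h => this ⟨hwx.1, h⟩]
      rw [if_neg hwx]
      by_cases hwy : m ∧ w = y
      · rw [if_pos hwy]
      rw [if_neg hwy, if_neg fun h => hw h.1]
  have g1 : ∀ u ∉ B, u ∉ S → ¬ (m ∧ u = y) → (Pi.single u 1 : V → ℂ) ∈ N.map M := by
    intro u hu huS huy
    have hu0 : u ≠ u₀ := fun h => huS (h ▸ hu₀)
    refine single_mem_of_mem (Submodule.mem_map_of_mem (hDN u hu)) ?_ ?_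
    · rw [hMD u hu, if_neg (by simp [hu, huS]), if_neg hu0]
      by_cases hux : m ∧ u = x
      · rw [if_pos hux, if_pos (Or.inl hux.2)]
        exact hzne u hu huS
      · rw [if_neg hux, if_neg huy, if_pos ⟨rfl, huS⟩]
        exact hzne u hu huS
    · intro w hw h
      exfalso
      apply h
      rw [hMD u hu]
      by_cases hwB : w ∈ B ∨ (w ∈ S ∧ w ≠ u₀)
      · rw [if_pos hwB]
      rw [if_neg hwB]
      by_cases hw0 : w = u₀
      · rw [if_pos hw0, if_neg huS]
      rw [if_neg hw0]
      by_cases hwx : m ∧ w = x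
      · rw [if_pos hwx, if_neg]
        rintro (h | h)
        · exact hw (hwx.2.trans h.symm)
        · exact huy ⟨hwx.1, h⟩
      rw [if_neg hwx]
      by_cases hwy : m ∧ w = y
      · rw [if_pos hwy]
      rw [if_neg hwy, if_neg fun h => hw h.1]
  -- The derivations preserve `z_x = z_y` and never reach row `y`; the coordinate vector at `y`,
  -- which lies in `N`, does.
  have g2 : m → (Pi.single y 1 : V → ℂ) ∈ N.map M := by
    intro hm'
    obtain ⟨hxS, hyS, -, -⟩ := hm hm'
    have hy0 : y ≠ u₀ := fun h => hyS (h ▸ hu₀)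
    refine single_mem_of_mem (hsingle y hy0) ?_ ?_
    · simp [M, row, hy, hyS, hy0, hm', hxy, hxy.symm]
    · intro w hw h
      by_cases hwB : w ∈ B ∨ (w ∈ S ∧ w ≠ u₀)
      · exact absurd (hzero y w hwB hw) h
      · by_cases hw0 : w = u₀
        · exact hw0 ▸ g0
        · exact g1 w (fun h => hwB (Or.inl h)) (fun h => hwB (Or.inr ⟨h, hw0⟩)) (fun h => hw h.2)
  have g3 : ∀ v, (v ∈ B ∨ (v ∈ S ∧ v ≠ u₀)) → (Pi.single v 1 : V → ℂ) ∈ N.map M := by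
    intro v hv'
    have hv0 : v ≠ u₀ := by
      rintro rfl
      exact hv'.elim hu₀B fun h => h.2 rfl
    refine single_mem_of_mem (hsingle v hv0) ?_ ?_
    · simp [M, row, hv']
    · intro w hw h
      by_cases hwB : w ∈ B ∨ (w ∈ S ∧ w ≠ u₀)
      · exact absurd (hzero v w hwB hw) h
      · by_cases hw0 : w = u₀
        · exact hw0 ▸ g0
        · by_cases hwy : m ∧ w = y
          · exact hwy.2 ▸ g2 hwy.1
          · exact g1 w (fun h => hwB (Or.inl h)) (fun h => hwB (Or.inr ⟨h, hw0⟩)) hwy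
  have hN : N = ⊤ := by
    refine eq_top_of_map_eq_top (M := M) (eq_top_of_forall_single_mem fun v => ?_)
    by_cases hvB : v ∈ B ∨ (v ∈ S ∧ v ≠ u₀)
    · exact g3 v hvB
    · by_cases hv0 : v = u₀
      · exact hv0 ▸ g0
      · by_cases hvy : m ∧ v = y
        · exact hvy.2 ▸ g2 hvy.1
        · exact g1 v (fun h => hvB (Or.inl h)) (fun h => hvB (Or.inr ⟨h, hv0⟩)) hvy
  have : (Pi.single u₀ 1 : V → ℂ) ∈ N := hN ▸ Submodule.mem_top
  simp [N] at this

end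

/-! ### Nondegeneracy at generic weights -/

section

/-- The pairs `(q, z)` such that `z` takes distinct values at the ends of every edge. -/
def separated {V E : Type*} (s t : E → V) : Set ((E → ℂ) × (V → ℂ)) := {p | ∀ e, p.2 (s e) ≠ p.2 (t e)}

lemma isOpen_separated {V E : Type*} [Finite E] {s t : E → V} : IsOpen (separated s t) := by
  simp only [separated, Set.ofPred_forall]
  exact isOpen_iInter_of_finite fun e => isOpen_ne_fun (by fun_prop) (by fun_prop)

variable {V : Type*} {E : Type*} [Fintype E] [DecidableEq V] {s t : E → V} {B : Set V}

section Nondegenerate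

variable [Fintype V] {k : IntermediateField ℚ ℂ} {q : E → ℝ} {b z : V → ℂ} {x y : V}

open Classical in
/-- For generic `q`, if the two merged vertices of a solution were solutions separately, then
their positions would be different. -/
lemma GenericIn.flux_ne_zero_of_eq (hq : GenericIn k (chargeFree s t B) q)
    (hJ : JoinedToBoundary s t B) (hB : B.Nontrivial) (hb : Set.InjOn b B)
    (hbk : ∀ v ∈ B, b v ∈ k) (hzB : ∀ v ∈ B, z v = b v) (hx : x ∉ B) (hy : y ∉ B) (hxy : x ≠ y)
    (hzxy : z x = z y) (hsum : flux s t (fun e => (q e : ℂ)) z x +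
      flux s t (fun e => (q e : ℂ)) z y = 0)
    (hflux : ∀ u ∉ B, u ≠ x → u ≠ y → flux s t (fun e => (q e : ℂ)) z u = 0) :
    flux s t (fun e => (q e : ℂ)) z x ≠ 0 := by
  intro h0
  have hflux' : ∀ u ∉ B, flux s t (fun e => (q e : ℂ)) z u = 0 := by
    intro u hu
    by_cases hux : u = x
    · exact hux ▸ h0
    · by_cases huy : u = y
      · rw [h0, zero_add] at hsum
        exact huy ▸ hsum
      · exact hflux u hu hux huy
  obtain ⟨v₁, h₁, v₂, h₂, hv⟩ := hB
  choose! D hD using fun u (hu : u ∉ B) => hq.exists_variation hJ h₁ h₂ hu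
  let M : (V → ℂ) →ₗ[ℂ] (V → ℂ) := LinearMap.pi fun v =>
    if v ∈ B then LinearMap.proj v else fluxDeriv s t (fun e => (q e : ℂ)) z v
  -- All vectors `D u z` lie in the hyperplane `ζ_x = ζ_y`, since `z_x = z_y`. If also `F_x = F_y =
  -- 0`, their images under the full differential yield every interior coordinate vector, and the
  -- hyperplane would be the whole space.
  let N : Submodule ℂ (V → ℂ) :=
    LinearMap.ker ((LinearMap.proj x : (V → ℂ) →ₗ[ℂ] ℂ) - LinearMap.proj y)
  have hMD : ∀ u ∉ B, ∀ w, M (fun v => D u (z v)) w =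
      if w ∈ B then 0 else if w = u then (z u - z v₁)⁻¹ - (z u - z v₂)⁻¹ else 0 := by
    intro u hu w
    by_cases hw : w ∈ B
    · simp only [M, LinearMap.pi_apply, hw, if_true, LinearMap.proj_apply, hzB w hw]
      exact (D u).map_algebraMap ⟨b w, hbk w hw⟩
    · simp only [M, LinearMap.pi_apply, hw, if_false]
      have h := congrArg (D u) (hflux' w hw)
      have h' := (hD u hu ∅ (fun v _ => Set.notMem_empty v) z).1 w hw
      rw [mask_empty] at h'
      rw [map_zero, derivation_flux, h'] at h
      simpa using (sub_eq_zero.1 h).symm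
  have hsingle : ∀ v, (Pi.single v 1 : V → ℂ) ∈ N.map M := by
    have hint : ∀ u ∉ B, (Pi.single u 1 : V → ℂ) ∈ N.map M := by
      intro u hu
      have hN : (fun v => D u (z v)) ∈ N := by simp [N, hzxy]
      refine single_mem_of_mem (Submodule.mem_map_of_mem hN) ?_ ?_
      · rw [hMD u hu, if_neg hu, if_pos rfl]
        intro h
        rw [sub_eq_zero, inv_inj, sub_right_inj, hzB _ h₁, hzB _ h₂] at h
        exact hv (hb h₁ h₂ h)
      · intro w hw h
        rw [hMD u hu] at h
        simp [hw] at h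
    intro v
    by_cases hvB : v ∈ B
    · have hN : (Pi.single v 1 : V → ℂ) ∈ N := by
        have h1 : x ≠ v := fun h => hx (h ▸ hvB)
        have h2 : y ≠ v := fun h => hy (h ▸ hvB)
        simp [N, h1, h2]
      refine single_mem_of_mem (Submodule.mem_map_of_mem hN) ?_ ?_
      · simp [M, hvB]
      · intro w hw h
        refine hint w fun hwB => h ?_
        simp [M, hwB, hw]
    · exact hint v hvB
  have hN : N = ⊤ := eq_top_of_map_eq_top (eq_top_of_forall_single_mem hsingle)
  have : (Pi.single x 1 : V → ℂ) ∈ N := hN ▸ Submodule.mem_top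
  simp [N, hxy.symm] at this

end Nondegenerate

/-! ### The relaxed equations -/

variable (s t B) in
/-- The equations with the two equations at `x` and `y` replaced by their sum and by
`(z_x - z_y) (l F_x + m) = l Q_x`, where `F` and `Q` are the flux and the charge. -/
def relaxed (b : V → ℂ) (x y : V) (l m : ℂ) (p : (E → ℂ) × (V → ℂ)) : V → ℂ :=
  open Classical in fun v =>
    if v ∈ B then p.2 v - b v
    else if v = x then flux s t p.1 p.2 x + flux s t p.1 p.2 y
    else if v = y then (p.2 x - p.2 y) * (l * flux s t p.1 p.2 x + m) - l * charge s t p.1 x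
    else flux s t p.1 p.2 v

variable (s t B) in
/-- The differential of the relaxed equations in `z`. -/
def relaxedDeriv (q : E → ℂ) (z : V → ℂ) (x y : V) (l m : ℂ) : (V → ℂ) →ₗ[ℂ] (V → ℂ) :=
  open Classical in LinearMap.pi fun v =>
    if v ∈ B then LinearMap.proj v
    else if v = x then -(fluxDeriv s t q z x + fluxDeriv s t q z y)
    else if v = y then (l * flux s t q z x + m) •
      ((LinearMap.proj x : (V → ℂ) →ₗ[ℂ] ℂ) - LinearMap.proj y) -
        ((z x - z y) * l) • fluxDeriv s t q z x
    else -fluxDeriv s t q z v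

section RelaxedZero

variable {b : V → ℂ} {x y : V} {l m : ℂ} {q : E → ℂ} {z : V → ℂ}

lemma relaxed_eq_zero_iff (hx : x ∉ B) (hy : y ∉ B) (hxy : x ≠ y) :
    relaxed s t B b x y l m (q, z) = 0 ↔ (∀ v ∈ B, z v = b v) ∧
      flux s t q z x + flux s t q z y = 0 ∧
      (z x - z y) * (l * flux s t q z x + m) = l * charge s t q x ∧
      ∀ u ∉ B, u ≠ x → u ≠ y → flux s t q z u = 0 := by
  constructor
  · intro h
    refine ⟨fun v hv => ?_, ?_, ?_, fun u hu hux huy => ?_⟩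
    · have := congrFun h v
      simpa [relaxed, hv, sub_eq_zero] using this
    · have := congrFun h x
      simpa [relaxed, hx] using this
    · have := congrFun h y
      simpa [relaxed, hy, hxy.symm, sub_eq_zero] using this
    · have := congrFun h u
      simpa [relaxed, hu, hux, huy] using this
  · rintro ⟨h1, h2, h3, h4⟩
    ext v
    simp only [relaxed, Pi.zero_apply]
    split_ifs with hv hvx hvy
    · rw [h1 v hv, sub_self]
    · exact h2
    · rw [h3, sub_self]
    · exact h4 v hv hvx hvy

end RelaxedZero

section Nondegenerate

variable [Fintype V] {k : IntermediateField ℚ ℂ} {q : E → ℝ} {b z : V → ℂ} {x y : V} {l m : ℂ}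

open Classical in
/-- At a generic point the zeros of the relaxed equations are nondegenerate. -/
lemma GenericIn.relaxedDeriv_bijective (hq : GenericIn k (chargeFree s t B) q)
    (hJ : JoinedToBoundary s t B) (hB : B.Nontrivial) (hb : Set.InjOn b B)
    (hbk : ∀ v ∈ B, b v ∈ k) (hx : x ∉ B) (hy : y ∉ B) (hxy : x ≠ y)
    (hlm : l = 1 ∧ m = 0 ∨ l = 0 ∧ m = 1)
    (hz : relaxed s t B b x y l m (fun e => (q e : ℂ), z) = 0) :
    Function.Bijective (relaxedDeriv s t B (fun e => (q e : ℂ)) z x y l m) := by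
  obtain ⟨hzB, hsum, hrel, hflux⟩ := (relaxed_eq_zero_iff hx hy hxy).1 hz
  rw [hq.1 x hx, mul_zero] at hrel
  set Q : E → ℂ := fun e => (q e : ℂ) with hQ
  -- The two factors of the limiting equation do not vanish together, so its zeros are simple across
  -- the two branches.
  have hne : z x = z y → l * flux s t Q z x + m ≠ 0 := by
    intro h
    rcases hlm with ⟨rfl, rfl⟩ | ⟨rfl, rfl⟩
    · rw [one_mul, add_zero]
      exact hq.flux_ne_zero_of_eq hJ hB hb hbk hzB hx hy hxy h hsum hflux
    · simp
  obtain ⟨v₁, h₁, v₂, h₂, hv⟩ := hB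
  choose! D hD using fun u (hu : u ∉ B) => hq.exists_variation hJ h₁ h₂ hu
  set M := relaxedDeriv s t B Q z x y l m with hM
  have hDl : ∀ u, D u l = 0 ∧ D u m = 0 := by
    intro u
    rcases hlm with ⟨rfl, rfl⟩ | ⟨rfl, rfl⟩ <;> simp
  have hκ : ∀ u, (z u - z v₁)⁻¹ - (z u - z v₂)⁻¹ ≠ 0 := by
    intro u h
    rw [sub_eq_zero, inv_inj, sub_right_inj, hzB _ h₁, hzB _ h₂] at h
    exact hv (hb h₁ h₂ h)
  have hfd : ∀ u ∉ B, ∀ w ∉ B, D u (flux s t Q z w) =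
      (if w = u then (z u - z v₁)⁻¹ - (z u - z v₂)⁻¹ else 0) -
        fluxDeriv s t Q z w (fun v => D u (z v)) := by
    intro u hu w hw
    have h' := (hD u hu ∅ (fun v _ => Set.notMem_empty v) z).1 w hw
    rw [mask_empty] at h'
    rw [derivation_flux, hQ, h']
    simp
  have hMD : ∀ u ∉ B, ∀ w, M (fun v => D u (z v)) w =
      if w ∈ B then 0
      else if w = x then (if u = x ∨ u = y then -((z u - z v₁)⁻¹ - (z u - z v₂)⁻¹) else 0)
      else if w = y then
        (if u = x then -((z x - z y) * l * ((z u - z v₁)⁻¹ - (z u - z v₂)⁻¹)) else 0)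
      else if w = u then -((z u - z v₁)⁻¹ - (z u - z v₂)⁻¹) else 0 := by
    intro u hu w
    simp only [hM, relaxedDeriv, LinearMap.pi_apply]
    by_cases hw : w ∈ B
    · simp only [hw, if_true, LinearMap.proj_apply, hzB w hw]
      exact (D u).map_algebraMap ⟨b w, hbk w hw⟩
    simp only [hw, if_false]
    by_cases hwx : w = x
    · simp only [hwx, if_true, LinearMap.neg_apply, LinearMap.add_apply]
      have h := congrArg (D u) hsum
      rw [map_add, map_zero, hfd u hu x hx, hfd u hu y hy] at h
      by_cases hux : u = x
      · subst hux
        simp only [true_or, if_true, hxy.symm, if_false] at h ⊢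
        linear_combination h
      · by_cases huy : u = y
        · subst huy
          simp only [or_true, if_true, hxy, if_false] at h ⊢
          linear_combination h
        · simp only [hux, huy, Ne.symm hux, Ne.symm huy, or_self, if_false] at h ⊢
          linear_combination h
    simp only [hwx, if_false]
    by_cases hwy : w = y
    · simp only [hwy, if_true, LinearMap.sub_apply, LinearMap.smul_apply, LinearMap.proj_apply,
        smul_eq_mul]
      have h := congrArg (D u) hrel
      rw [Derivation.leibniz, map_add, Derivation.leibniz, map_sub, map_zero, (hDl u).1, (hDl u).2,
        hfd u hu x hx] at h
      simp only [smul_eq_mul] at h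
      by_cases hux : u = x
      · simp only [hux, if_true] at h ⊢
        linear_combination h
      · simp only [hux, Ne.symm hux, if_false] at h ⊢
        linear_combination h
    simp only [hwy, if_false, LinearMap.neg_apply]
    have h := congrArg (D u) (hflux w hw hwx hwy)
    rw [hfd u hu w hw, map_zero, sub_eq_zero] at h
    rw [← h]
    split_ifs <;> simp
  let R := LinearMap.range M
  have hmem : ∀ ζ, M ζ ∈ R := fun ζ => LinearMap.mem_range_self M ζ
  have hBzero : ∀ v ∉ B, ∀ w ∈ B, M (Pi.single v 1) w = 0 := by
    intro v hv' w hw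
    have : w ≠ v := fun h => hv' (h ▸ hw)
    simp [hM, relaxedDeriv, hw, this]
  have g1 : ∀ u ∉ B, u ≠ x → u ≠ y → (Pi.single u 1 : V → ℂ) ∈ R := by
    intro u hu hux huy
    refine single_mem_of_mem (hmem fun v => D u (z v)) ?_ fun w hw h => absurd ?_ h
    · rw [hMD u hu, if_neg hu, if_neg hux, if_neg huy, if_pos rfl]
      exact neg_ne_zero.2 (hκ u)
    · rw [hMD u hu]
      simp [hux, huy, hw]
  -- Varying the weights at `y` changes `F_y` but not `F_x`, so only the summed row is affected.
  have g2 : (Pi.single x 1 : V → ℂ) ∈ R := by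
    refine single_mem_of_mem (hmem fun v => D y (z v)) ?_ fun w hw h => absurd ?_ h
    · rw [hMD y hy, if_neg hx, if_pos rfl, if_pos (Or.inr rfl)]
      exact neg_ne_zero.2 (hκ y)
    · rw [hMD y hy]
      simp only [hw, hxy.symm, if_false]
      split_ifs <;> rfl
  -- On the branch `z_x = z_y` the derivations miss row `y`, but moving `z_y` changes it by the
  -- nonzero factor `-(l F_x + m)`. On the branch `z_x ≠ z_y` necessarily `l = 1`, and varying the
  -- weights at `x` reaches row `y`.
  have g3 : (Pi.single y 1 : V → ℂ) ∈ R := by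
    by_cases hzxy : z x = z y
    · refine single_mem_of_mem (hmem (Pi.single y 1)) ?_ fun w hw h => ?_
      · simpa [hM, relaxedDeriv, hy, hxy, hxy.symm, hzxy, add_eq_zero_iff_eq_neg,
          neg_eq_iff_eq_neg] using (fun h => hne hzxy (by rw [h]; ring) :
          ¬ (m = -(l * flux s t Q z x)))
      · by_cases hwx : w = x
        · exact hwx ▸ g2
        · exact g1 w (fun hwB => h (hBzero y hy w hwB)) hwx hw
    · have hl : l ≠ 0 := by
        rintro rfl
        rcases hlm with ⟨h, -⟩ | ⟨-, rfl⟩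
        · exact zero_ne_one h
        · simp [sub_eq_zero, hzxy] at hrel
      refine single_mem_of_mem (hmem fun v => D x (z v)) ?_ fun w hw h => ?_
      · rw [hMD x hx, if_neg hy, if_neg hxy.symm, if_pos rfl, if_pos rfl]
        exact neg_ne_zero.2 (mul_ne_zero (mul_ne_zero (sub_ne_zero.2 hzxy) hl) (hκ x))
      · by_cases hwx : w = x
        · exact hwx ▸ g2
        · refine absurd ?_ h
          rw [hMD x hx]
          simp [hw, hwx]
  have hint : ∀ u ∉ B, (Pi.single u 1 : V → ℂ) ∈ R := by
    intro u hu
    by_cases hux : u = x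
    · exact hux ▸ g2
    · by_cases huy : u = y
      · exact huy ▸ g3
      · exact g1 u hu hux huy
  have hsurj : Function.Surjective M := by
    rw [← LinearMap.range_eq_top]
    refine eq_top_of_forall_single_mem fun v => ?_
    by_cases hvB : v ∈ B
    · refine single_mem_of_mem (hmem (Pi.single v 1)) ?_ fun w hw h => hint w fun hwB => h ?_
      · simp [hM, relaxedDeriv, hvB]
      · simp [hM, relaxedDeriv, hwB, hw]
    · exact hint v hvB
  exact ⟨LinearMap.injective_iff_surjective.2 hsurj, hsurj⟩

end Nondegenerate

section Derivative

variable {b z : V → ℂ} {x y : V} {l m : ℂ} {q : E → ℂ}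

lemma hasDerivAt_relaxed (hz : (q, z) ∈ separated s t) (ζ : V → ℂ) :
    HasDerivAt (fun τ : ℂ => relaxed s t B b x y l m (q, z + τ • ζ))
      (relaxedDeriv s t B q z x y l m ζ) 0 := by
  rw [hasDerivAt_pi]
  intro v
  have hv : ∀ v, HasDerivAt (fun τ : ℂ => (z + τ • ζ) v) (ζ v) 0 := by
    intro v
    simpa using ((hasDerivAt_id (0 : ℂ)).mul_const (ζ v)).const_add (z v)
  have hf := fun u => hasDerivAt_flux q hz ζ u
  simp only [relaxed, relaxedDeriv, LinearMap.pi_apply]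
  split_ifs
  · exact (hv v).sub_const _
  · refine ((hf x).add (hf y)).congr_deriv ?_
    simp only [LinearMap.neg_apply, LinearMap.add_apply]
    ring
  · refine ((((hv x).sub (hv y)).mul (((hf x).const_mul l).add_const m)).sub_const _).congr_deriv ?_
    simp
    ring
  · exact hf v

variable [Fintype V]

lemma contDiffAt_flux (hz : (q, z) ∈ separated s t) (u : V) :
    ContDiffAt ℂ 1 (fun p : (E → ℂ) × (V → ℂ) => flux s t p.1 p.2 u) (q, z) := by
  refine ContDiffAt.sum fun e _ => ContDiffAt.mul (by fun_prop) ?_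
  exact ContDiffAt.div (by fun_prop) (by fun_prop) (sub_ne_zero.2 (hz e))

lemma contDiffAt_relaxed (hz : (q, z) ∈ separated s t) :
    ContDiffAt ℂ 1 (relaxed s t B b x y l m) (q, z) := by
  rw [contDiffAt_pi]
  intro v
  have hx := contDiffAt_flux hz x
  have hy := contDiffAt_flux hz y
  simp only [relaxed]
  split_ifs
  · fun_prop
  · exact hx.add hy
  · have hc : ContDiff ℂ 1 fun p : (E → ℂ) × (V → ℂ) => charge s t p.1 x := by
      simp only [charge, chargeAgainst]
      fun_prop
    exact ((by fun_prop : ContDiffAt ℂ 1 (fun p : (E → ℂ) × (V → ℂ) => p.2 x - p.2 y) (q, z)).mul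
      ((contDiffAt_const.mul hx).add contDiffAt_const)).sub
      (contDiffAt_const.mul hc.contDiffAt)
  · exact contDiffAt_flux hz v

/-- The system is `C¹` on the separated set, and the partial differential in `z` is identified by
derivatives along lines. In finite dimension bijectivity gives a continuous inverse. -/
lemma exists_hasStrictFDerivAt_relaxed (hz : (q, z) ∈ separated s t)
    (hbij : Function.Bijective (relaxedDeriv s t B q z x y l m)) :
    ∃ F' : (E → ℂ) × (V → ℂ) →L[ℂ] (V → ℂ),
      HasStrictFDerivAt (relaxed s t B b x y l m) F' (q, z) ∧
      (F' ∘L .inr ℂ (E → ℂ) (V → ℂ)).IsInvertible := by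
  have hF := (contDiffAt_relaxed (B := B) (b := b) (x := x) (y := y) (l := l) (m := m) hz)
    |>.hasStrictFDerivAt one_ne_zero
  refine ⟨_, hF, (LinearEquiv.ofBijective _ hbij).toContinuousLinearEquiv, ?_⟩
  ext1 ζ
  have hline : HasDerivAt (fun τ : ℂ => (q, z + τ • ζ)) ((0 : E → ℂ), ζ) 0 := by
    refine (hasDerivAt_const _ _).prodMk ?_
    simpa using ((hasDerivAt_id (0 : ℂ)).smul_const ζ).const_add z
  have h1 : HasFDerivAt (relaxed s t B b x y l m) (fderiv ℂ (relaxed s t B b x y l m) (q, z))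
      (q, z + (0 : ℂ) • ζ) := by
    rw [zero_smul, add_zero]
    exact hF.hasFDerivAt
  have h2 := HasFDerivAt.comp_hasDerivAt (f := fun τ : ℂ => (q, z + τ • ζ)) (0 : ℂ) h1 hline
  exact (hasDerivAt_relaxed (b := b) hz ζ).unique h2

end Derivative

end

/-! ### Properness and the number of relaxed solutions -/

section

variable {V : Type*} {E : Type*} [Fintype E] [DecidableEq V] {s t : E → V} {B : Set V}

variable (s t B) in
/-- The weights on the edges whose sum vanishes at all vertices outside `B` except `x` and `y`,
and at these two vertices has the same value or, for `l = 0`, opposite values. -/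
def relaxedWeights (x y : V) (l : ℂ) : Set (E → ℂ) :=
  {q | (∀ u ∉ B, u ≠ x → u ≠ y → charge s t q u = 0) ∧
    (l = 1 → charge s t q x = charge s t q y) ∧ (l = 0 → charge s t q x + charge s t q y = 0)}

variable {b : V → ℂ} {x y : V} {l m : ℂ}

lemma continuous_charge (u : V) : Continuous fun q : E → ℂ => charge s t q u := by
  simp only [charge, chargeAgainst]
  fun_prop

variable [Fintype V]

lemma sum_mul_eq_of_eq_zero {f : V → ℂ} (hxy : x ≠ y) {g : V → ℂ} (hg : ∀ v ∈ B, g v = 0)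
    (hf : ∀ u ∉ B, u ≠ x → u ≠ y → f u = 0) : ∑ u, g u * f u = g x * f x + g y * f y := by
  refine Eq.trans ?_ (Finset.sum_pair (f := fun u => g u * f u) hxy)
  symm
  refine Finset.sum_subset (Finset.subset_univ _) fun u _ hu => ?_
  simp only [Finset.mem_insert, Finset.mem_singleton, not_or] at hu
  by_cases huB : u ∈ B
  · rw [hg u huB, zero_mul]
  · rw [hf u huB hu.1 hu.2, mul_zero]

variable {𝒰 : Ultrafilter ((E → ℂ) × (V → ℂ))}

/-- Only `x` and `y` contribute to the weak form. For `l = 1` the contribution is `(g_x - g_y) F_x -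
(h_x + h_y) Q_x`; multiplied by `z_x - z_y` it becomes `Q_x ((g_x - g_y) - (h_x + h_y)(z_x - z_y))`,
so it is `O(Q_x)` and tends to `0`. For `l = 0` the equality `z_x = z_y` makes it vanish exactly. -/
lemma asympSolution_of_relaxed (hx : x ∉ B) (hy : y ∉ B) (hxy : x ≠ y)
    (hlm : l = 1 ∧ m = 0 ∨ l = 0 ∧ m = 1) {q₀ : E → ℂ} (hq₀ : charge s t q₀ x = 0)
    (hq : Tendsto Prod.fst (𝒰 : Filter ((E → ℂ) × (V → ℂ))) (𝓝[relaxedWeights s t B x y l] q₀))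
    (hz : ∀ᶠ p in (𝒰 : Filter ((E → ℂ) × (V → ℂ))), relaxed s t B b x y l m p = 0) :
    AsympSolution s t B x y 𝒰 Prod.fst Prod.snd := by
  rintro g h hgh hmerge ⟨C, hC⟩
  have hqW : ∀ᶠ p in (𝒰 : Filter ((E → ℂ) × (V → ℂ))), p.1 ∈ relaxedWeights s t B x y l :=
    hq.eventually eventually_mem_nhdsWithin
  have hQ : Tendsto (fun p : (E → ℂ) × (V → ℂ) => charge s t p.1 x) 𝒰 (𝓝 0) := by
    rw [← hq₀]
    exact ((continuous_charge x).tendsto q₀).comp (hq.mono_right nhdsWithin_le_nhds)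
  have hsum : ∀ᶠ p in (𝒰 : Filter ((E → ℂ) × (V → ℂ))),
      fluxAgainst s t p.1 p.2 (g p) - chargeAgainst s t p.1 (h p) =
        (g p x - g p y) * flux s t p.1 p.2 x -
          (h p x * charge s t p.1 x + h p y * charge s t p.1 y) := by
    filter_upwards [hz, hqW] with p hp hpW
    obtain ⟨-, hp2, -, hp4⟩ := (relaxed_eq_zero_iff hx hy hxy).1 hp
    rw [fluxAgainst_eq_sum, chargeAgainst_eq_sum,
      sum_mul_eq_of_eq_zero hxy (fun v hv => (hgh p v hv).1) hp4,
      sum_mul_eq_of_eq_zero hxy (fun v hv => (hgh p v hv).2) hpW.1]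
    linear_combination g p y * hp2
  have hQ' : Tendsto (fun p : (E → ℂ) × (V → ℂ) => C * ‖charge s t p.1 x‖) 𝒰 (𝓝 0) := by
    simpa using hQ.norm.const_mul C
  rcases hlm with ⟨rfl, rfl⟩ | ⟨rfl, rfl⟩
  · refine squeeze_zero_norm' ?_ hQ'
    filter_upwards [hsum, hz, hqW, hmerge, hC] with p hp hpz hpW hpm hpC
    obtain ⟨-, -, hp3, -⟩ := (relaxed_eq_zero_iff hx hy hxy).1 hpz
    rw [one_mul, one_mul, add_zero] at hp3
    rw [hp, ← hpW.2.1 rfl]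
    by_cases hpxy : p.2 x = p.2 y
    · rw [hpxy, sub_self, zero_mul] at hp3
      rw [(hpm hpxy).1, ← hp3]
      simp
    · have hd : 0 < ‖p.2 x - p.2 y‖ := norm_pos_iff.2 (sub_ne_zero.2 hpxy)
      refine le_of_mul_le_mul_right ?_ hd
      rw [← norm_mul]
      calc _ = ‖charge s t p.1 x * ((g p x - g p y) - (h p x + h p y) * (p.2 x - p.2 y))‖ := by
            congr 1
            linear_combination (g p x - g p y) * hp3
        _ ≤ ‖charge s t p.1 x‖ * (C * ‖p.2 x - p.2 y‖) := by
            rw [norm_mul]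
            gcongr
        _ = _ := by ring
  · refine tendsto_const_nhds.congr' ?_
    filter_upwards [hsum, hz, hqW, hmerge] with p hp hpz hpW hpm
    obtain ⟨-, -, hp3, -⟩ := (relaxed_eq_zero_iff hx hy hxy).1 hpz
    rw [zero_mul, zero_mul, zero_add, mul_one, sub_eq_zero] at hp3
    obtain ⟨h1, h2⟩ := hpm hp3
    rw [hp, h1, h2]
    linear_combination h p y * hpW.2.2 rfl

open Classical in
/-- At a generic point the relaxed equations are proper. -/
lemma GenericIn.exists_tendsto_of_relaxed {k : IntermediateField ℚ ℂ} {q₀ : E → ℝ}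
    (hgen : GenericIn k (chargeFree s t B) q₀) (hJ : JoinedToBoundary s t B) (hB : B.Nontrivial)
    (hb : Set.InjOn b B) (hbk : ∀ v ∈ B, b v ∈ k) (hx : x ∉ B) (hy : y ∉ B) (hxy : x ≠ y)
    (hlm : l = 1 ∧ m = 0 ∨ l = 0 ∧ m = 1)
    (hq : Tendsto Prod.fst (𝒰 : Filter ((E → ℂ) × (V → ℂ)))
      (𝓝[relaxedWeights s t B x y l] fun e => (q₀ e : ℂ)))
    (hz : ∀ᶠ p in (𝒰 : Filter ((E → ℂ) × (V → ℂ))),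
      p ∈ separated s t ∧ relaxed s t B b x y l m p = 0) :
    ∃ z, ((fun e => (q₀ e : ℂ), z) ∈ separated s t ∧
      relaxed s t B b x y l m (fun e => (q₀ e : ℂ), z) = 0) ∧
      Tendsto Prod.snd (𝒰 : Filter ((E → ℂ) × (V → ℂ))) (𝓝 z) := by
  set Q : E → ℂ := fun e => (q₀ e : ℂ)
  have hsep : ∀ᶠ p in (𝒰 : Filter ((E → ℂ) × (V → ℂ))), ∀ e, p.2 (s e) ≠ p.2 (t e) :=
    hz.mono fun p hp => hp.1
  have hrel := hz.mono fun p hp => (relaxed_eq_zero_iff hx hy hxy).1 hp.2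
  have H := asympSolution_of_relaxed hx hy hxy hlm (hgen.1 x hx) hq (hz.mono fun p hp => hp.2)
  have hqe : ∀ e, Tendsto (fun p : (E → ℂ) × (V → ℂ) => p.1 e) 𝒰 (𝓝 (Q e)) :=
    tendsto_pi_nhds.1 (hq.mono_right nhdsWithin_le_nhds)
  have hQ : Tendsto (fun p : (E → ℂ) × (V → ℂ) => charge s t p.1 x) 𝒰 (𝓝 0) := by
    rw [← hgen.1 x hx]
    exact ((continuous_charge x).tendsto Q).comp (hq.mono_right nhdsWithin_le_nhds)
  let S : Set V := {v | Tendsto (fun p : (E → ℂ) × (V → ℂ) => p.2 v) 𝒰 (Bornology.cobounded ℂ)}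
  -- The value `0` on escaping vertices is a convention: it removes the edges inside `S` from the
  -- escape relation and is killed by derivations.
  have hlim : ∀ v, ∃ a, (v ∈ S → a = 0) ∧
      (v ∉ S → Tendsto (fun p : (E → ℂ) × (V → ℂ) => p.2 v) 𝒰 (𝓝 a)) := by
    intro v
    by_cases hv : v ∈ S
    · exact ⟨0, fun _ => rfl, fun h => absurd hv h⟩
    · obtain ⟨a, ha⟩ := (tendsto_cobounded_or_exists_tendsto _).resolve_left hv
      exact ⟨a, fun h => absurd h hv, fun _ => ha⟩
  choose z₀ hz₀S hz₀ using hlim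
  have hBlim : ∀ v ∈ B, Tendsto (fun p : (E → ℂ) × (V → ℂ) => p.2 v) 𝒰 (𝓝 (b v)) := fun v hv =>
    tendsto_const_nhds.congr' (hrel.mono fun p hp => (hp.1 v hv).symm)
  have hSB : ∀ v ∈ B, v ∉ S := fun v hv hvS => by
    have h := tendsto_cobounded_sub hvS (hBlim v hv)
    have h' := (hBlim v hv).sub_const (b v)
    rw [sub_self] at h'
    obtain ⟨p, h1, h2⟩ := ((eventually_ne_zero_of_cobounded h).and
      (hrel.and (h'.eventually_ne one_ne_zero.symm))).exists
    exact h1 (by rw [h2.1.1 v hv, sub_self])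
  have hz₀B : ∀ v ∈ B, z₀ v = b v := fun v hv =>
    tendsto_nhds_unique (hz₀ v (hSB v hv)) (hBlim v hv)
  have hz₀ne : ∀ e, s e ∉ S → t e ∉ S → z₀ (s e) ≠ z₀ (t e) := by
    intro e hs ht heq
    have h := (hz₀ _ hs).sub (hz₀ _ ht)
    rw [heq, sub_self] at h
    obtain ⟨S', h1, h2, h3, h4⟩ := H.exists_cluster hqe hsep hb (hrel.mono fun p hp => hp.1) h
    exact hgen.sum_inside_ne_zero hJ hB h1 h2 h3 h4
  rcases S.eq_empty_or_nonempty with hS | hS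
  · have hzlim : Tendsto Prod.snd (𝒰 : Filter ((E → ℂ) × (V → ℂ))) (𝓝 z₀) :=
      tendsto_pi_nhds.2 fun v => hz₀ v (hS ▸ Set.notMem_empty v)
    have hz₀sep : (Q, z₀) ∈ separated s t := fun e =>
      hz₀ne e (hS ▸ Set.notMem_empty _) (hS ▸ Set.notMem_empty _)
    refine ⟨z₀, ⟨hz₀sep, ?_⟩, hzlim⟩
    have hc := (contDiffAt_relaxed (B := B) (b := b) (x := x) (y := y) (l := l) (m := m)
      hz₀sep).continuousAt.tendsto
    have hp : Tendsto (fun p : (E → ℂ) × (V → ℂ) => p) 𝒰 (𝓝 (Q, z₀)) :=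
      (hq.mono_right nhdsWithin_le_nhds).prodMk_nhds hzlim
    exact tendsto_nhds_unique (hc.comp hp)
      (tendsto_const_nhds.congr' (hz.mono fun p hp => hp.2.symm))
  · exfalso
    have hflux : ∀ u ∉ S, Tendsto (fun p : (E → ℂ) × (V → ℂ) => flux s t p.1 p.2 u) 𝒰
        (𝓝 (flux s t (mask s t S Q) z₀ u)) := fun u hu =>
      tendsto_flux hqe (fun v hv => hv) hz₀ hz₀ne hu
    -- Unless `x` and `y` merge or both escape, `1 / (z_x - z_y)` converges, so `F_x = Q_x / (z_x -
    -- z_y)` tends to `0` and the two equations hold separately in the limit. For `l = 0` this case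
    -- does not occur.
    have hflux_x : ¬ (x ∉ S ∧ y ∉ S ∧ z₀ x = z₀ y) → (x ∉ S ∨ y ∉ S) →
        Tendsto (fun p : (E → ℂ) × (V → ℂ) => flux s t p.1 p.2 x) 𝒰 (𝓝 0) := by
      intro hnm hor
      obtain ⟨hne, a, ha⟩ : (∀ᶠ p in (𝒰 : Filter ((E → ℂ) × (V → ℂ))), p.2 x - p.2 y ≠ 0) ∧
          ∃ a, Tendsto (fun p : (E → ℂ) × (V → ℂ) => (p.2 x - p.2 y)⁻¹) 𝒰 (𝓝 a) := by
        by_cases hxS : x ∈ S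
        · have hyS : y ∉ S := hor.resolve_left (not_not.2 hxS)
          have h := tendsto_cobounded_sub hxS (hz₀ y hyS)
          exact ⟨eventually_ne_zero_of_cobounded h, 0, tendsto_inv₀_cobounded.comp h⟩
        · by_cases hyS : y ∈ S
          · have h := tendsto_cobounded_sub hyS (hz₀ x hxS)
            refine ⟨(eventually_ne_zero_of_cobounded h).mono fun p hp hp' =>
              hp (by rw [← neg_sub, hp', neg_zero]), -0,
              (tendsto_inv₀_cobounded.comp h).neg.congr fun p => ?_⟩
            rw [Function.comp_apply, ← inv_neg, neg_sub]
          · have hne : z₀ x - z₀ y ≠ 0 := sub_ne_zero.2 fun h => hnm ⟨hxS, hyS, h⟩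
            have h := (hz₀ x hxS).sub (hz₀ y hyS)
            exact ⟨h.eventually_ne hne, _, h.inv₀ hne⟩
      have h := hQ.mul ha
      rw [zero_mul] at h
      refine h.congr' ?_
      filter_upwards [hne, hrel] with p hp hprel
      have hp3 := hprel.2.2.1
      rcases hlm with ⟨rfl, rfl⟩ | ⟨rfl, rfl⟩
      · rw [one_mul, one_mul, add_zero] at hp3
        rw [← hp3]
        field_simp
      · rw [zero_mul, zero_mul, zero_add, mul_one] at hp3
        exact absurd hp3 hp
    have hsum : Tendsto (fun p : (E → ℂ) × (V → ℂ) =>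
        flux s t p.1 p.2 x + flux s t p.1 p.2 y) 𝒰 (𝓝 0) :=
      tendsto_const_nhds.congr' (hrel.mono fun p hp => hp.2.1.symm)
    refine hgen.not_escape_relation hJ hB hb hbk hS hSB hz₀B (fun v hv => hz₀S v hv) hx hy hxy
      (x ∉ S ∧ y ∉ S ∧ z₀ x = z₀ y) (fun hm => ⟨hm.1, hm.2.1, hm.2.2, ?_⟩) ?_
      (H.escape_relation hqe hsep hSB (fun v hv => hv) hz₀S hz₀)
    · exact tendsto_nhds_unique ((hflux x hm.1).add (hflux y hm.2.1)) hsum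
    · intro u hu huS hum
      refine tendsto_nhds_unique (hflux u huS) ?_
      by_cases hux : u = x
      · subst hux
        exact hflux_x (fun h => hum ⟨h, Or.inl rfl⟩) (Or.inl huS)
      · by_cases huy : u = y
        · subst huy
          have h := hsum.sub (hflux_x (fun h => hum ⟨h, Or.inr rfl⟩) (Or.inr huS))
          rw [sub_zero] at h
          exact h.congr fun p => add_sub_cancel_left _ _
        · exact tendsto_const_nhds.congr' (hrel.mono fun p hp => (hp.2.2.2 u hu hux huy).symm)

variable (s t B) in
/-- The separated solutions of the relaxed equations. -/
def relaxedSolutions (b : V → ℂ) (x y : V) (l m : ℂ) (q : E → ℂ) : Set (V → ℂ) :=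
  {z | (q, z) ∈ separated s t ∧ relaxed s t B b x y l m (q, z) = 0}

/-- At a generic point there are finitely many relaxed solutions, and their number is locally
constant. -/
theorem GenericIn.encard_relaxedSolutions {k : IntermediateField ℚ ℂ} {q₀ : E → ℝ}
    (hgen : GenericIn k (chargeFree s t B) q₀) (hJ : JoinedToBoundary s t B) (hB : B.Nontrivial)
    (hb : Set.InjOn b B) (hbk : ∀ v ∈ B, b v ∈ k) (hx : x ∉ B) (hy : y ∉ B) (hxy : x ≠ y)
    (hlm : l = 1 ∧ m = 0 ∨ l = 0 ∧ m = 1) :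
    (relaxedSolutions s t B b x y l m fun e => (q₀ e : ℂ)).Finite ∧
      ∀ᶠ q in 𝓝[relaxedWeights s t B x y l] fun e => (q₀ e : ℂ),
        (relaxedSolutions s t B b x y l m q).encard =
          (relaxedSolutions s t B b x y l m fun e => (q₀ e : ℂ)).encard := by
  refine encard_zeros_eventually_eq (relaxed s t B b x y l m) (separated s t) isOpen_separated
    (relaxedWeights s t B x y l) (fun e => (q₀ e : ℂ)) ?_ ?_ ?_
  · have h0 := fun u hu => hgen.1 u hu
    exact ⟨fun u hu _ _ => h0 u hu, fun _ => by rw [h0 x hx, h0 y hy],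
      fun _ => by rw [h0 x hx, h0 y hy, add_zero]⟩
  · exact fun z hzU hz => exists_hasStrictFDerivAt_relaxed hzU
      (hgen.relaxedDeriv_bijective hJ hB hb hbk hx hy hxy hlm hz)
  · exact fun 𝒰 hq hz => hgen.exists_tendsto_of_relaxed hJ hB hb hbk hx hy hxy hlm hq hz

end

section

variable {α : Type*} {β : Type*}

/-! ### Graphs with a choice of directions of the edges -/

section Count

variable {H : Graph α β} {B : Set α} {b : B → ℂ}

/-- The equations are rational in `q` and `z` over `ℚ`, so a field automorphism, even a
discontinuous one, carries solutions to solutions. -/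
lemma mem_solutions_of_ringEquiv (τ : ℂ ≃+* ℂ) (hb : ∀ v, τ (b v) = b v) {q q' : H.edgeSet → ℝ}
    (hq : ∀ e, τ (q e) = q' e) {z : H.vertexSet → ℂ} (hz : z ∈ solutions H B b q) :
    (fun v => τ (z v)) ∈ solutions H B b q' := by
  obtain ⟨h1, h2, h3⟩ := hz
  refine ⟨fun v hv => ?_, fun e u v he h => h2 e u v he (τ.injective h), fun u hu => ?_⟩
  · exact (congrArg τ (h1 v hv)).trans (hb _)
  · have h := congrArg τ.toAddEquiv (h3 u hu)
    rw [AddEquiv.map_finsum, map_zero] at h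
    rw [← h]
    refine finsum_congr fun p => ?_
    rw [AddEquiv.map_finsum]
    refine finsum_congr fun _ => ?_
    simp [hq]

/-- The real functions on the edges that satisfy `QSum`. -/
def qSumSubmodule (H : Graph α β) [Finite H.vertexSet] [Finite H.edgeSet] (B : Set α) :
    Submodule ℝ (H.edgeSet → ℝ) where
  carrier := {q | QSum H B q}
  add_mem' {q q'} h h' u hu := by
    classical
    have := Fintype.ofFinite H.vertexSet
    have := Fintype.ofFinite H.edgeSet
    have h1 := h u hu
    have h2 := h' u hu
    simp only [finsum_eq_if, finsum_eq_sum_of_fintype] at h1 h2 ⊢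
    refine Eq.trans ?_ ((congrArg₂ (· + ·) h1 h2).trans (add_zero 0))
    rw [← Finset.sum_add_distrib]
    refine Finset.sum_congr rfl fun p _ => ?_
    split_ifs <;> simp
  zero_mem' u hu := by simp
  smul_mem' c q h u hu := by
    classical
    have := Fintype.ofFinite H.vertexSet
    have := Fintype.ofFinite H.edgeSet
    have h1 := h u hu
    simp only [finsum_eq_if, finsum_eq_sum_of_fintype] at h1 ⊢
    refine Eq.trans ?_ ((congrArg (c * ·) h1).trans (mul_zero c))
    rw [Finset.mul_sum]
    refine Finset.sum_congr rfl fun p _ => ?_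
    split_ifs <;> simp

variable [Finite H.vertexSet] [Finite H.edgeSet]

lemma isGeneric_iff {q : H.edgeSet → ℝ} : IsGeneric H B b q ↔
    GenericIn (IntermediateField.adjoin ℚ (Set.range b)) (qSumSubmodule H B) q := Iff.rfl

/-- The number of solutions is the same for all generic functions. -/
lemma encard_solutions_le [Finite B] {q q' : H.edgeSet → ℝ}
    (hq : IsGeneric H B b q) (hq' : IsGeneric H B b q') :
    (solutions H B b q).encard ≤ (solutions H B b q').encard := by
  have := countable_adjoin (Set.finite_range b).countable
  obtain ⟨τ, h1, h2⟩ := GenericIn.exists_ringEquiv (isGeneric_iff.1 hq) (isGeneric_iff.1 hq')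
  have hb : ∀ v, τ (b v) = b v := fun v =>
    h1 ⟨b v, IntermediateField.subset_adjoin ℚ _ ⟨v, rfl⟩⟩
  refine Set.encard_le_encard_of_injOn (f := fun z v => τ (z v))
    (fun z hz => mem_solutions_of_ringEquiv τ hb h2 hz) ?_
  intro z _ z' _ h
  ext v
  exact τ.injective (congrFun h v)

lemma isGenericCount_of_encard_eq [Finite B] {q : H.edgeSet → ℝ} (hq : IsGeneric H B b q) {n : ℕ}
    (hn : (solutions H B b q).encard = n) : IsGenericCount H B b n :=
  ⟨⟨q, hq⟩, fun _ hq' => (le_antisymm (encard_solutions_le hq' hq)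
    (encard_solutions_le hq hq')).trans hn⟩

end Count

/-! ### From graphs to directed edges -/

section Conversion

variable {H : Graph α β} [Fintype H.vertexSet] [DecidableEq H.vertexSet] [Finite H.edgeSet] {B : Set α} {b : B → ℂ}
  {ι : Type*} [Fintype ι] (φ : ι ≃ H.edgeSet) {s t : ι → H.vertexSet}

/-- Each edge appears once in each direction. A self-loop would appear once on the left and twice on
the right, which is why `hne` is required. -/
lemma finsum_isLink_eq (hst : ∀ i, H.IsLink (φ i) (s i) (t i)) (hne : ∀ i, s i ≠ t i)
    {M : Type*} [AddCommMonoid M] (f : H.edgeSet → H.vertexSet → M) (u : H.vertexSet) :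
    ∑ᶠ (p : H.edgeSet × H.vertexSet) (_ : H.IsLink p.1 u p.2), f p.1 p.2 =
      ∑ i, ((if s i = u then f (φ i) (t i) else 0) + (if t i = u then f (φ i) (s i) else 0)) := by
  classical
  have := Fintype.ofFinite H.edgeSet
  simp only [finsum_eq_if, finsum_eq_sum_of_fintype]
  rw [Fintype.sum_prod_type, ← Equiv.sum_comp φ]
  refine Finset.sum_congr rfl fun i _ => ?_
  have hiff : ∀ v : H.vertexSet, H.IsLink (φ i) u v ↔ (s i = u ∧ t i = v) ∨ (t i = u ∧ s i = v) := by
    intro v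
    rw [(hst i).isLink_iff]
    simp only [Subtype.ext_iff]
    tauto
  simp only [hiff]
  by_cases hs : s i = u
  · have ht : t i ≠ u := fun h => hne i (hs.trans h.symm)
    simp [hs, ht]
  · by_cases ht : t i = u <;> simp [hs, ht]

lemma qSum_iff_charge (hst : ∀ i, H.IsLink (φ i) (s i) (t i)) (hne : ∀ i, s i ≠ t i)
    {q : H.edgeSet → ℝ} : QSum H B q ↔
      ∀ u ∉ ((↑) ⁻¹' B : Set H.vertexSet), charge s t (fun i => (q (φ i) : ℂ)) u = 0 := by
  refine forall₂_congr fun u hu => ?_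
  rw [finsum_isLink_eq φ hst hne (fun e _ => q e) u, ← Complex.ofReal_eq_zero, charge,
    chargeAgainst, Complex.ofReal_sum]
  refine Eq.congr_left (Finset.sum_congr rfl fun i _ => ?_)
  simp only [Pi.single_apply]
  split_ifs <;> simp [mul_add]

/-- The boundary values as a function on all vertices. -/
def boundaryValue (H : Graph α β) (b : B → ℂ) (v : H.vertexSet) : ℂ :=
  open Classical in if hv : (v : α) ∈ B then b ⟨v, hv⟩ else 0

/-- The solutions in terms of the fluxes. -/
def fluxSolutions {V : Type*} [DecidableEq V] (s t : ι → V) (B : Set V) (b : V → ℂ) (q : ι → ℂ) :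
    Set (V → ℂ) :=
  {z | (∀ v ∈ B, z v = b v) ∧ (∀ i, z (s i) ≠ z (t i)) ∧ ∀ u ∉ B, flux s t q z u = 0}

lemma solutions_eq_fluxSolutions (hst : ∀ i, H.IsLink (φ i) (s i) (t i)) (hne : ∀ i, s i ≠ t i)
    {q : H.edgeSet → ℝ} : solutions H B b q =
      fluxSolutions s t ((↑) ⁻¹' B : Set H.vertexSet) (boundaryValue H b) fun i => (q (φ i) : ℂ) := by
  ext z
  refine and_congr (forall₂_congr fun v hv => ?_) (and_congr ?_ (forall₂_congr fun u hu => ?_))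
  · have hv' : (v : α) ∈ B := hv
    rw [boundaryValue, dif_pos hv']
  · constructor
    · exact fun h i => h (φ i) (s i) (t i) (hst i)
    · intro h e u v he
      obtain ⟨i, hi⟩ := φ.surjective ⟨e, he.edge_mem⟩
      have hi' : (φ i : β) = e := congrArg Subtype.val hi
      have hl := hst i
      rw [hi'] at hl
      rcases hl.eq_and_eq_or_eq_and_eq he with ⟨h1, h2⟩ | ⟨h1, h2⟩
      · rw [← Subtype.ext h1, ← Subtype.ext h2]
        exact h i
      · rw [← Subtype.ext h1, ← Subtype.ext h2]
        exact (h i).symm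
  · rw [finsum_isLink_eq φ hst hne (fun e v => (q e : ℂ) / (z u - z v)) u, flux, fluxAgainst]
    refine Eq.congr_left (Finset.sum_congr rfl fun i _ => ?_)
    simp only [Pi.single_apply]
    by_cases hs : s i = u
    · have ht : t i ≠ u := fun h => hne i (hs.trans h.symm)
      simp [hs, ht, div_eq_mul_inv]
    · by_cases ht : t i = u
      · simp only [hs, ht, if_true, if_false, zero_add, zero_sub]
        rw [← neg_sub (z u) (z (s i)), neg_div_neg_eq, mul_one_div]
      · simp [hs, ht]

end Conversion

end

section

/-! ### The relaxed solutions in terms of deletion and contraction -/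

section Deletion

variable {V : Type*} {E : Type*} [Fintype E] [DecidableEq V] {s t : E → V}
  {B : Set V} {b : V → ℂ} {x y : V}

/-- With `Q_x = 0` the last equation factors as `(z_x - z_y) F_x = 0`; this is the source of the two
terms of the recurrence. -/
lemma relaxedSolutions_one_zero_eq_union (hx : x ∉ B) (hy : y ∉ B) (hxy : x ≠ y) {q : E → ℂ}
    (hq : charge s t q x = 0) : relaxedSolutions s t B b x y 1 0 q =
      fluxSolutions s t B b q ∪ relaxedSolutions s t B b x y 0 1 q := by
  ext z
  simp only [relaxedSolutions, fluxSolutions, Set.mem_union, Set.mem_ofPred_eq,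
    relaxed_eq_zero_iff hx hy hxy, hq, one_mul, zero_mul, add_zero, zero_add, mul_one, mul_zero,
    mul_eq_zero, sub_eq_zero]
  constructor
  · rintro ⟨h1, h2, h3, h4 | h4, h5⟩
    · exact Or.inr ⟨h1, h2, h3, h4, h5⟩
    · refine Or.inl ⟨h2, h1, fun u hu => ?_⟩
      rw [h4, zero_add] at h3
      by_cases hux : u = x
      · rw [hux, h4]
      · by_cases huy : u = y
        · rw [huy, h3]
        · exact h5 u hu hux huy
  · rintro (⟨h1, h2, h3⟩ | ⟨h1, h2, h3, h4, h5⟩)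
    · exact ⟨h2, h1, by rw [h3 x hx, h3 y hy, add_zero], Or.inr (h3 x hx), fun u hu _ _ => h3 u hu⟩
    · exact ⟨h1, h2, h3, Or.inl h4, h5⟩

lemma GenericIn.disjoint_relaxedSolutions [Fintype V] {k : IntermediateField ℚ ℂ} {q : E → ℝ}
    (hq : GenericIn k (chargeFree s t B) q) (hJ : JoinedToBoundary s t B) (hB : B.Nontrivial)
    (hb : Set.InjOn b B) (hbk : ∀ v ∈ B, b v ∈ k) (hx : x ∉ B) (hy : y ∉ B) (hxy : x ≠ y) :
    Disjoint (fluxSolutions s t B b fun e => (q e : ℂ))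
      (relaxedSolutions s t B b x y 0 1 fun e => (q e : ℂ)) := by
  rw [Set.disjoint_left]
  rintro z ⟨h1, -, h3⟩ ⟨-, h⟩
  obtain ⟨-, h4, h5, h6⟩ := (relaxed_eq_zero_iff hx hy hxy).1 h
  rw [zero_mul, zero_mul, zero_add, mul_one, sub_eq_zero] at h5
  exact hq.flux_ne_zero_of_eq hJ hB hb hbk h1 hx hy hxy h5 h4 h6 (h3 x hx)

lemma charge_option_elim (q : Option E → ℂ) (u : V) :
    charge (fun i => i.elim x s) (fun i => i.elim y t) q u =
      q none * ((Pi.single u 1 : V → ℂ) x + (Pi.single u 1 : V → ℂ) y) +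
        charge s t (fun i => q (some i)) u := by
  simp [charge, chargeAgainst, Fintype.sum_option]

lemma flux_option_elim (q : Option E → ℂ) (z : V → ℂ) (u : V) :
    flux (fun i => i.elim x s) (fun i => i.elim y t) q z u =
      q none * (((Pi.single u 1 : V → ℂ) x - (Pi.single u 1 : V → ℂ) y) / (z x - z y)) +
        flux s t (fun i => q (some i)) z u := by
  simp [flux, fluxAgainst, Fintype.sum_option]

/-- Adding an edge with a weight other than zero. -/
lemma fluxSolutions_option_elim (hx : x ∉ B) (hy : y ∉ B) (hxy : x ≠ y) {q : Option E → ℂ}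
    (h0 : q none ≠ 0) (hq : charge s t (fun i => q (some i)) x = -q none) :
    fluxSolutions (fun i : Option E => i.elim x s) (fun i => i.elim y t) B b q =
      relaxedSolutions s t B b x y 1 0 fun i => q (some i) := by
  ext z
  simp only [relaxedSolutions, fluxSolutions, Set.mem_ofPred_eq, Option.forall, Option.elim_none,
    Option.elim_some, relaxed_eq_zero_iff hx hy hxy, hq, one_mul, add_zero, flux_option_elim,
    separated]
  constructor
  · rintro ⟨h1, ⟨h2, h3⟩, h4⟩
    have h5 := h4 x hx
    have h6 := h4 y hy
    simp only [Pi.single_eq_same, Pi.single_eq_of_ne hxy, Pi.single_eq_of_ne hxy.symm] at h5 h6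
    refine ⟨h3, h1, ?_, ?_, fun u hu hux huy => ?_⟩
    · linear_combination h5 + h6
    · have h2' := sub_ne_zero.2 h2
      field_simp at h5
      linear_combination h5
    · simpa [hux.symm, huy.symm] using h4 u hu
  · rintro ⟨h1, h2, h3, h4, h5⟩
    -- The relaxed system separates the ends of the new edge automatically, because its weight is
    -- not zero.
    have h6 : z x - z y ≠ 0 := fun h => h0 (by simpa [h] using h4)
    have h7 : q none * (1 / (z x - z y)) + flux s t (fun i => q (some i)) z x = 0 := by
      field_simp
      linear_combination h4
    refine ⟨h2, ⟨sub_ne_zero.1 h6, h1⟩, fun u hu => ?_⟩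
    by_cases hux : u = x
    · subst hux
      simpa [hxy.symm] using h7
    · by_cases huy : u = y
      · subst huy
        simp only [Pi.single_eq_same, Pi.single_eq_of_ne hxy]
        linear_combination h3 - h7
      · simpa [Ne.symm hux, Ne.symm huy] using h5 u hu hux huy

end Deletion

section Contraction

variable {V V' : Type*} {E : Type*} [Fintype E] [DecidableEq V] [DecidableEq V'] {s t : E → V}
  {x y : V} {r : V → V'}

lemma single_comp_eq_single (hr : ∀ u v, r u = r v → u = v ∨ u = x ∧ v = y ∨ u = y ∧ v = x) {u : V}
    (hux : u ≠ x) (huy : u ≠ y) : (Pi.single (r u) 1 : V' → ℂ) ∘ r = Pi.single u 1 := by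
  ext v
  have : r v = r u ↔ v = u := ⟨fun h => by grind, fun h => h ▸ rfl⟩
  simp [Pi.single_apply, this]

lemma single_comp_eq_add (hr : ∀ u v, r u = r v → u = v ∨ u = x ∧ v = y ∨ u = y ∧ v = x)
    (hxy : x ≠ y) (hrxy : r x = r y) :
    (Pi.single (r x) 1 : V' → ℂ) ∘ r = Pi.single x 1 + Pi.single y 1 := by
  ext v
  have : r v = r x ↔ v = x ∨ v = y := ⟨fun h => by grind, by grind⟩
  simp only [Function.comp_apply, Pi.single_apply, this, Pi.add_apply]
  by_cases hvx : v = x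
  · simp [hvx, hxy]
  · simp [hvx]

lemma charge_comp_eq (hr : ∀ u v, r u = r v → u = v ∨ u = x ∧ v = y ∨ u = y ∧ v = x) (q : E → ℂ)
    {u : V} (hux : u ≠ x) (huy : u ≠ y) :
    charge (r ∘ s) (r ∘ t) q (r u) = charge s t q u := by
  rw [charge, charge, ← single_comp_eq_single hr hux huy]
  rfl

lemma charge_comp_eq_add (hr : ∀ u v, r u = r v → u = v ∨ u = x ∧ v = y ∨ u = y ∧ v = x)
    (hxy : x ≠ y) (hrxy : r x = r y) (q : E → ℂ) :
    charge (r ∘ s) (r ∘ t) q (r x) = charge s t q x + charge s t q y := by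
  have h : charge (r ∘ s) (r ∘ t) q (r x) = chargeAgainst s t q (Pi.single (r x) 1 ∘ r) := rfl
  rw [h, single_comp_eq_add hr hxy hrxy, charge, charge, chargeAgainst, chargeAgainst,
    chargeAgainst, ← Finset.sum_add_distrib]
  refine Finset.sum_congr rfl fun e _ => ?_
  simp only [Pi.add_apply]
  ring

lemma flux_comp_eq (hr : ∀ u v, r u = r v → u = v ∨ u = x ∧ v = y ∨ u = y ∧ v = x) (q : E → ℂ)
    (z : V' → ℂ) {u : V} (hux : u ≠ x) (huy : u ≠ y) :
    flux (r ∘ s) (r ∘ t) q z (r u) = flux s t q (z ∘ r) u := by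
  rw [flux, flux, ← single_comp_eq_single hr hux huy]
  rfl

lemma flux_comp_eq_add (hr : ∀ u v, r u = r v → u = v ∨ u = x ∧ v = y ∨ u = y ∧ v = x)
    (hxy : x ≠ y) (hrxy : r x = r y) (q : E → ℂ) (z : V' → ℂ) :
    flux (r ∘ s) (r ∘ t) q z (r x) = flux s t q (z ∘ r) x + flux s t q (z ∘ r) y := by
  have h : flux (r ∘ s) (r ∘ t) q z (r x) =
    fluxAgainst s t q (z ∘ r) (Pi.single (r x) 1 ∘ r) := rfl
  rw [h, single_comp_eq_add hr hxy hrxy, flux, flux, fluxAgainst, fluxAgainst,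
    fluxAgainst, ← Finset.sum_add_distrib]
  refine Finset.sum_congr rfl fun e _ => ?_
  simp only [Pi.add_apply]
  ring

variable {B' : Set V'} {b' : V' → ℂ}

/-- Identifying the vertices `x` and `y`. -/
lemma encard_fluxSolutions_comp
    (hr : ∀ u v, r u = r v → u = v ∨ u = x ∧ v = y ∨ u = y ∧ v = x) (hxy : x ≠ y)
    (hrxy : r x = r y) (hrs : Function.Surjective r) (hx : r x ∉ B') (q : E → ℂ) :
    (fluxSolutions (r ∘ s) (r ∘ t) B' b' q).encard =
      (relaxedSolutions s t (r ⁻¹' B') (b' ∘ r) x y 0 1 q).encard := by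
  rw [← hrs.injective_comp_right.encard_image]
  congr 1
  ext z
  have hx' : x ∉ r ⁻¹' B' := hx
  have hy' : y ∉ r ⁻¹' B' := fun h => hx (by rwa [hrxy])
  simp only [relaxedSolutions, fluxSolutions, Set.mem_image, Set.mem_ofPred_eq, separated,
    relaxed_eq_zero_iff hx' hy' hxy, zero_mul, zero_add, mul_one, sub_eq_zero]
  constructor
  · rintro ⟨z, ⟨h1, h2, h3⟩, rfl⟩
    refine ⟨h2, fun v hv => h1 _ hv, ?_, congrArg z hrxy, fun u hu hux huy => ?_⟩
    · rw [← flux_comp_eq_add hr hxy hrxy]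
      exact h3 _ hx
    · rw [← flux_comp_eq hr q z hux huy]
      exact h3 _ hu
  · rintro ⟨h1, h2, h3, h4, h5⟩
    obtain ⟨z, rfl⟩ : ∃ z' : V' → ℂ, z' ∘ r = z := by
      refine ⟨fun v => z (Function.surjInv hrs v), funext fun v => ?_⟩
      rcases hr _ _ (Function.surjInv_eq hrs (r v)) with h | ⟨h, h'⟩ | ⟨h, h'⟩
      · simp only [Function.comp_apply, h]
      · rw [Function.comp_apply, h, h', h4]
      · rw [Function.comp_apply, h, h', h4]
    refine ⟨z, ⟨?_, h1, ?_⟩, rfl⟩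
    · intro v hv
      obtain ⟨v, rfl⟩ := hrs v
      exact h2 v hv
    · intro u hu
      obtain ⟨u, rfl⟩ := hrs u
      by_cases hux : u = x
      · rw [hux, flux_comp_eq_add hr hxy hrxy, h3]
      · by_cases huy : u = y
        · rw [huy, ← hrxy, flux_comp_eq_add hr hxy hrxy, h3]
        · rw [flux_comp_eq hr q z hux huy]
          exact h5 u hu hux huy

end Contraction

/-- Transfers a locally constant count from the base point to a generic function nearby. -/
lemma exists_isGeneric_of_eventually {α β : Type*} {H : Graph α β} [Finite H.vertexSet]
    [Finite H.edgeSet] {B : Set α} [Finite B] (b : B → ℂ) {q₀ : H.edgeSet → ℝ}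
    (hq₀ : QSum H B q₀) {p : (H.edgeSet → ℝ) → Prop} (hp : ∀ᶠ q in 𝓝[{q | QSum H B q}] q₀, p q) :
    ∃ q, IsGeneric H B b q ∧ p q := by
  have := countable_adjoin (Set.finite_range b).countable
  obtain ⟨q, hq, hq'⟩ := GenericIn.exists_mem_nhds
    (k := IntermediateField.adjoin ℚ (Set.range b)) (qSumSubmodule H B) hq₀
    (eventually_nhdsWithin_iff.1 hp)
  exact ⟨q, hq', hq hq'.1⟩

end

/-! ### Generic functions near the base point -/

section

section Recurrence

variable {α β : Type*} {G : Graph α β} {B : Set α} {b : B → ℂ} {e : β}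

/-- Edges are directed away from an interior end. Deleting `e` keeps all adjacencies with the
boundary because both ends of `e` are interior. -/
lemma exists_joinedToBoundary (hint : ∀ e u v, G.IsLink e u v → u ∉ B ∨ v ∉ B)
    (hjoin : ∀ u ∈ G.vertexSet, u ∉ B → ∀ v ∈ B, G.Adj u v)
    {x y : α} (he : G.IsLink e x y) (hx : x ∉ B) (hy : y ∉ B) :
    ∃ s t : (G.deleteEdges {e}).edgeSet → G.vertexSet, (∀ i : (G.deleteEdges {e}).edgeSet, G.IsLink i (s i) (t i)) ∧
      JoinedToBoundary s t ((↑) ⁻¹' B) := by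
  have h : ∀ i : (G.deleteEdges {e}).edgeSet, ∃ u v : G.vertexSet, G.IsLink i u v ∧ (u : α) ∉ B := by
    intro i
    obtain ⟨u, v, huv⟩ := G.exists_isLink_of_mem_edgeSet i.2.1
    rcases hint i u v huv with hu | hv
    · exact ⟨⟨u, huv.left_mem⟩, ⟨v, huv.right_mem⟩, huv, hu⟩
    · exact ⟨⟨v, huv.right_mem⟩, ⟨u, huv.left_mem⟩, huv.symm, hv⟩
  choose s t hst hs using h
  refine ⟨s, t, hst, hs, fun u hu v hv => ?_⟩
  obtain ⟨f, hf⟩ := hjoin u u.2 hu v hv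
  have hfe : f ≠ e := by
    rintro rfl
    rcases hf.right_eq_or_eq he with h | h
    · exact hx (h ▸ hv)
    · exact hy (h ▸ hv)
  refine ⟨⟨f, hf.edge_mem, hfe⟩, ?_⟩
  rcases (hst ⟨f, hf.edge_mem, hfe⟩).eq_and_eq_or_eq_and_eq hf with ⟨h1, h2⟩ | ⟨h1, h2⟩
  · exact ⟨Subtype.ext h1, Subtype.ext h2⟩
  · exact absurd (show (s _ : α) ∈ B by rwa [h1]) (hs _)

/-- The edges of `G` are `e` and the edges of `G - e`. -/
def optionEquivEdgeSet (he : e ∈ G.edgeSet) : Option (G.deleteEdges {e}).edgeSet ≃ G.edgeSet :=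
  Equiv.ofBijective (fun o => o.elim ⟨e, he⟩ fun i => ⟨i, i.2.1⟩) <| by
    constructor
    · rintro (_ | i) (_ | j) h
      · rfl
      · exact absurd (congrArg Subtype.val h).symm j.2.2
      · exact absurd (congrArg Subtype.val h) i.2.2
      · exact congrArg some (Subtype.ext (congrArg (fun f : G.edgeSet => (f : β)) h))
    · intro i
      by_cases hi : (i : β) = e
      · exact ⟨none, Subtype.ext hi.symm⟩
      · exact ⟨some ⟨i, i.2, hi⟩, rfl⟩

variable [Fintype G.vertexSet] [DecidableEq G.vertexSet]
  [Fintype (G.deleteEdges {e}).edgeSet] [Finite B]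
  {s t : (G.deleteEdges {e}).edgeSet → G.vertexSet} {x y : G.vertexSet}

/-- Extending `q₀` by `0` on `e` gives an admissible function on `G`. A generic `q` close to it has
`q_e ≠ 0`, and its restriction has charge `-q_e` at both `x` and `y`, so its solutions are the
relaxed solutions near `q₀`. -/
lemma exists_isGeneric_encard_eq [Finite G.edgeSet]
    (hst : ∀ i : (G.deleteEdges {e}).edgeSet, G.IsLink i (s i) (t i)) (hne : ∀ i, s i ≠ t i)
    (hJ : JoinedToBoundary s t ((↑) ⁻¹' B))
    (hB : ((↑) ⁻¹' B : Set G.vertexSet).Nonempty)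
    (he : G.IsLink e x y) (hx : x ∉ ((↑) ⁻¹' B : Set G.vertexSet))
    (hy : y ∉ ((↑) ⁻¹' B : Set G.vertexSet)) (hxy : x ≠ y)
    {q₀ : (G.deleteEdges {e}).edgeSet → ℝ} (hq₀ : q₀ ∈ chargeFree s t ((↑) ⁻¹' B)) {n : ℕ∞}
    (h : ∀ᶠ q in 𝓝[relaxedWeights s t ((↑) ⁻¹' B) x y 1] fun i => (q₀ i : ℂ),
      (relaxedSolutions s t ((↑) ⁻¹' B) (boundaryValue G b) x y 1 0 q).encard = n) :
    ∃ q, IsGeneric G B b q ∧ (solutions G B b q).encard = n := by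
  classical
  set φ := optionEquivEdgeSet he.edge_mem
  set s' : Option (G.deleteEdges {e}).edgeSet → G.vertexSet := fun o => o.elim x s
  set t' : Option (G.deleteEdges {e}).edgeSet → G.vertexSet := fun o => o.elim y t
  have hst' : ∀ o, G.IsLink (φ o) (s' o) (t' o) := by
    rintro (_ | i)
    · exact he
    · exact hst i
  have hne' : ∀ o, s' o ≠ t' o := by
    rintro (_ | i)
    · exact hxy
    · exact hne i
  have hQ : ∀ q : G.edgeSet → ℝ, QSum G B q ↔ ∀ u ∉ ((↑) ⁻¹' B : Set G.vertexSet),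
      (q (φ none) : ℂ) * ((Pi.single u 1 : G.vertexSet → ℂ) x +
        (Pi.single u 1 : G.vertexSet → ℂ) y) +
          charge s t (fun i => (q (φ (some i)) : ℂ)) u = 0 := by
    intro q
    rw [qSum_iff_charge φ hst' hne']
    refine forall₂_congr fun u _ => ?_
    rw [charge_option_elim]
  have hQx : ∀ q : G.edgeSet → ℝ, QSum G B q →
      charge s t (fun i => (q (φ (some i)) : ℂ)) x = -(q (φ none) : ℂ) := by
    intro q hq
    have := (hQ q).1 hq x hx
    simp only [Pi.single_eq_same, Pi.single_eq_of_ne hxy.symm] at this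
    linear_combination this
  have hQW : ∀ q : G.edgeSet → ℝ, QSum G B q →
      (fun i => (q (φ (some i)) : ℂ)) ∈ relaxedWeights s t ((↑) ⁻¹' B) x y 1 := by
    intro q hq
    refine ⟨fun u hu hux huy => ?_, fun _ => ?_, fun h => absurd h one_ne_zero⟩
    · simpa [hux.symm, huy.symm] using (hQ q).1 hq u hu
    · rw [hQx q hq]
      have := (hQ q).1 hq y hy
      simp only [Pi.single_eq_same, Pi.single_eq_of_ne hxy] at this
      linear_combination -this
  have h0 : QSum G B fun i => (φ.symm i).elim 0 q₀ := by
    rw [hQ]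
    intro u hu
    simpa using hq₀ u hu
  have htend : Tendsto (fun (q : G.edgeSet → ℝ) i => (q (φ (some i)) : ℂ))
      (𝓝[{q | QSum G B q}] fun i => (φ.symm i).elim 0 q₀)
      (𝓝[relaxedWeights s t ((↑) ⁻¹' B) x y 1] fun i => (q₀ i : ℂ)) := by
    refine tendsto_nhdsWithin_iff.2 ⟨?_, eventually_nhdsWithin_of_forall fun q hq => hQW q hq⟩
    have hc : Continuous fun (q : G.edgeSet → ℝ) i => (q (φ (some i)) : ℂ) := by fun_prop
    have := hc.tendsto fun i => (φ.symm i).elim 0 q₀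
    simp only [Equiv.symm_apply_apply, Option.elim_some] at this
    exact this.mono_left nhdsWithin_le_nhds
  obtain ⟨q, hq, hqn⟩ := exists_isGeneric_of_eventually b h0 (htend.eventually h)
  refine ⟨q, hq, ?_⟩
  -- The condition admits `q_e = 1`, compensated on edges from `x` and `y` to a boundary vertex, so
  -- the coordinate `q_e` cannot vanish at a generic point.
  have hq0 : (q (φ none) : ℂ) ≠ 0 := by
    intro hq0
    obtain ⟨v, hv⟩ := hB
    obtain ⟨i, hi, hi'⟩ := hJ.exists_edge x hx v hv
    obtain ⟨j, hj, hj'⟩ := hJ.exists_edge y hy v hv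
    have hmem : QSum G B fun f => (φ.symm f).elim 1
        fun f => -((Pi.single i 1 : _ → ℝ) f + (Pi.single j 1 : _ → ℝ) f) := by
      rw [hQ]
      intro u hu
      have huv : v ≠ u := fun h => hu (h ▸ hv)
      have h1 := charge_sub (s := s) (t := t) (fun _ => 0)
        (fun f => ((Pi.single i 1 : _ → ℝ) f : ℂ) + ((Pi.single j 1 : _ → ℝ) f : ℂ)) u
      rw [charge_add, charge_single, charge_single, hi, hi', hj, hj'] at h1
      simp only [Pi.single_eq_of_ne huv, add_zero, Complex.ofReal_one, one_mul, zero_sub] at h1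
      simp only [Equiv.symm_apply_apply, Option.elim_none, Option.elim_some, Complex.ofReal_neg,
        Complex.ofReal_add, Complex.ofReal_one, one_mul, h1]
      simp [charge, chargeAgainst]
    have := hq.2 (MvPolynomial.X (φ none)) (by simpa using hq0) _ hmem
    simp at this
  rw [solutions_eq_fluxSolutions φ hst' hne', ← hqn]
  exact congrArg Set.encard (fluxSolutions_option_elim hx hy hxy hq0 (hQx q hq.1))

/-- Zero charge at `x` and at `y` gives zero charge at the merged vertex, so `q₀` is admissible on
the contraction. It satisfies one condition more than required there, so the count is carried to a
generic function nearby. -/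
lemma exists_isGeneric_contract_encard_eq (hst : ∀ i : (G.deleteEdges {e}).edgeSet, G.IsLink i (s i) (t i))
    (hx : x ∉ ((↑) ⁻¹' B : Set G.vertexSet))
    (hy : y ∉ ((↑) ⁻¹' B : Set G.vertexSet)) (hxy : x ≠ y)
    (hne : ∀ i, s i ≠ t i)
    {q₀ : (G.deleteEdges {e}).edgeSet → ℝ} (hq₀ : q₀ ∈ chargeFree s t ((↑) ⁻¹' B))
    (h : ∀ᶠ q in 𝓝[relaxedWeights s t ((↑) ⁻¹' B) x y 0] fun i => (q₀ i : ℂ),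
      (relaxedSolutions s t ((↑) ⁻¹' B) (boundaryValue G b) x y 0 1 q).encard =
        (relaxedSolutions s t ((↑) ⁻¹' B) (boundaryValue G b) x y 0 1
          fun i => (q₀ i : ℂ)).encard) :
    ∃ q, IsGeneric (contract G e x y) B b q ∧ (solutions (contract G e x y) B b q).encard =
      (relaxedSolutions s t ((↑) ⁻¹' B) (boundaryValue G b) x y 0 1
        fun i => (q₀ i : ℂ)).encard := by
  classical
  have hxy' : (x : α) ≠ y := fun h => hxy (Subtype.ext h)
  let H := contract G e x y
  let r : G.vertexSet → H.vertexSet := fun v => ⟨Function.update id (y : α) (x : α) v, v, v.2, by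
    congr!⟩
  have hrval : ∀ v : G.vertexSet, (r v : α) = if (v : α) = y then (x : α) else v := by
    intro v
    simp [r, Function.update_apply]
  have hrs : Function.Surjective r := by
    rintro ⟨_, v, hv, rfl⟩
    exact ⟨⟨v, hv⟩, Subtype.ext (by congr!)⟩
  have hr : ∀ u v, r u = r v → u = v ∨ u = x ∧ v = y ∨ u = y ∧ v = x := by
    intro u v huv
    have := congrArg Subtype.val huv
    rw [hrval, hrval] at this
    simp only [Subtype.ext_iff]
    split_ifs at this <;> grind
  have hrx : (r x : α) = x := by rw [hrval, if_neg hxy']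
  have hrxy : r x = r y := by
    refine Subtype.ext ?_
    rw [hrx, hrval, if_pos rfl]
  let φ : (G.deleteEdges {e}).edgeSet ≃ H.edgeSet := Equiv.refl _
  have hstH : ∀ i, H.IsLink (φ i) (r (s i)) (r (t i)) := by
    intro i
    refine ⟨s i, t i, ⟨hst i, i.2.2⟩, ?_, ?_⟩ <;> congr!
  have hrB : r ⁻¹' ((↑) ⁻¹' B) = ((↑) ⁻¹' B : Set G.vertexSet) := by
    ext v
    simp only [Set.mem_preimage, hrval]
    split_ifs with h
    · rw [h]
      exact iff_of_false hx hy
    · rfl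
  have hrb : boundaryValue H b ∘ r = boundaryValue G b := by
    ext v
    simp only [Function.comp_apply, boundaryValue, hrval]
    by_cases hv : (v : α) = y
    · have hx' : (x : α) ∉ B := hx
      have hy' : (y : α) ∉ B := hy
      simp [hv, hx', hy']
    · simp [hv]
  have : Finite H.vertexSet := Finite.of_surjective r hrs
  have : Finite H.edgeSet := inferInstanceAs (Finite (G.deleteEdges {e}).edgeSet)
  have := Fintype.ofFinite H.vertexSet
  -- An edge parallel to `e` becomes a self-loop. Then the contraction has no solutions, and neither
  -- has the relaxed system, where `z_x = z_y` contradicts separation along that edge.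
  by_cases hloop : ∃ i, r (s i) = r (t i)
  · have := countable_adjoin (Set.finite_range b).countable
    obtain ⟨q, -, hq⟩ := GenericIn.exists_mem_nhds
      (k := IntermediateField.adjoin ℚ (Set.range b)) (qSumSubmodule H B) (zero_mem _) univ_mem
    refine ⟨q, hq, ?_⟩
    obtain ⟨i, hi⟩ := hloop
    have h1 : solutions H B b q = ∅ := by
      refine Set.eq_empty_of_forall_notMem fun z hz => ?_
      exact hz.2.1 (φ i) _ _ (hstH i) (congrArg z hi)
    have h2 : relaxedSolutions s t ((↑) ⁻¹' B) (boundaryValue G b) x y 0 1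
        (fun i => (q₀ i : ℂ)) = ∅ := by
      refine Set.eq_empty_of_forall_notMem fun z hz => ?_
      have h3 := ((relaxed_eq_zero_iff hx hy hxy).1 hz.2).2.2.1
      rw [zero_mul, zero_mul, zero_add, mul_one, sub_eq_zero] at h3
      refine hz.1 i ?_
      rcases hr _ _ hi with h | ⟨h, h'⟩ | ⟨h, h'⟩
      · exact absurd h (hne i)
      · exact (congrArg z h).trans (h3.trans (congrArg z h').symm)
      · exact (congrArg z h).trans (h3.symm.trans (congrArg z h').symm)
    rw [h2, Set.encard_empty]
    exact Set.encard_eq_zero.2 h1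
  · have hneH : ∀ i, r (s i) ≠ r (t i) := not_exists.1 hloop
    have hQ : ∀ q : H.edgeSet → ℝ, QSum H B q ↔ ∀ u ∉ ((↑) ⁻¹' B : Set H.vertexSet),
        charge (r ∘ s) (r ∘ t) (fun i => (q (φ i) : ℂ)) u = 0 := fun q =>
      qSum_iff_charge (s := r ∘ s) (t := r ∘ t) φ hstH hneH
    have hrmem : ∀ u : G.vertexSet, r u ∉ ((↑) ⁻¹' B : Set H.vertexSet) ↔
        u ∉ ((↑) ⁻¹' B : Set G.vertexSet) := fun u => by rw [← hrB]; rfl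
    have h0 : QSum H B q₀ := by
      refine (hQ q₀).2 fun u hu => ?_
      obtain ⟨u, rfl⟩ := hrs u
      have h := (charge_comp_eq_add hr hxy hrxy _).trans
        ((congrArg₂ (· + ·) (hq₀ x hx) (hq₀ y hy)).trans (add_zero 0))
      by_cases hux : u = x
      · rw [hux]
        exact h
      · by_cases huy : u = y
        · rw [huy, ← hrxy]
          exact h
        · rw [charge_comp_eq hr _ hux huy]
          exact hq₀ u ((hrmem u).1 hu)
    have hQW : ∀ q : H.edgeSet → ℝ, QSum H B q →
        (fun i => (q (φ i) : ℂ)) ∈ relaxedWeights s t ((↑) ⁻¹' B) x y 0 := by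
      intro q hq
      rw [hQ] at hq
      refine ⟨fun u hu hux huy => ?_, fun h => absurd h.symm one_ne_zero, fun _ => ?_⟩
      · rw [← charge_comp_eq hr _ hux huy]
        exact hq _ ((hrmem u).2 hu)
      · rw [← charge_comp_eq_add hr hxy hrxy]
        exact hq _ ((hrmem x).2 hx)
    have htend : Tendsto (fun (q : H.edgeSet → ℝ) i => (q (φ i) : ℂ)) (𝓝[{q | QSum H B q}] q₀)
        (𝓝[relaxedWeights s t ((↑) ⁻¹' B) x y 0] fun i => (q₀ i : ℂ)) := by
      refine tendsto_nhdsWithin_iff.2 ⟨?_, eventually_nhdsWithin_of_forall fun q hq => hQW q hq⟩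
      have hc : Continuous fun (q : H.edgeSet → ℝ) i => (q (φ i) : ℂ) := by fun_prop
      exact (hc.tendsto q₀).mono_left nhdsWithin_le_nhds
    obtain ⟨q, hq, hqn⟩ := exists_isGeneric_of_eventually b h0 (htend.eventually h)
    refine ⟨q, hq, Eq.trans ?_ hqn⟩
    refine (congrArg Set.encard (solutions_eq_fluxSolutions (s := r ∘ s) (t := r ∘ t) φ
      hstH hneH)).trans ?_
    refine (encard_fluxSolutions_comp hr hxy hrxy hrs ((hrmem x).2 hx) _).trans ?_
    rw [hrB, hrb]

end Recurrence

end

end HQD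

end

theorem theorem5p1 {α : Type*} {β : Type*} (G : Graph α β) (B : Set α)
    (hV : G.vertexSet.Finite) (hE : G.edgeSet.Finite) (hG : G.Loopless)
    (hB : B ⊆ G.vertexSet) (hk : 2 ≤ B.ncard)
    (hint : ∀ e u v, G.IsLink e u v → u ∉ B ∨ v ∉ B)
    (hjoin : ∀ u ∈ G.vertexSet, u ∉ B → ∀ v ∈ B, G.Adj u v)
    (b : B → ℂ) (hb : Function.Injective b)
    (e : β) (x y : α) (he : G.IsLink e x y) (hx : x ∉ B) (hy : y ∉ B) :
    ∃ N N₁ N₂ : ℕ,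
      HQD.IsGenericCount G B b N ∧
      HQD.IsGenericCount (G.deleteEdges {e}) B b N₁ ∧
      HQD.IsGenericCount (HQD.contract G e x y) B b N₂ ∧
      N = N₁ + N₂ := by
  classical
  have := hV.fintype
  have := hE.to_subtype
  have : Finite B := (hV.subset hB).to_subtype
  have : Finite (G.deleteEdges {e}).edgeSet := (hE.subset fun _ h => h.1).to_subtype
  have : Fintype (G.deleteEdges {e}).vertexSet := hV.fintype
  have := Fintype.ofFinite (G.deleteEdges {e}).edgeSet
  obtain ⟨s, t, hst, hJ⟩ := HQD.exists_joinedToBoundary hint hjoin he hx hy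
  have hne : ∀ i, s i ≠ t i := by
    intro i h
    have := hst i
    rw [← h] at this
    exact hG.not_isLoopAt i (s i) this
  obtain ⟨x, rfl⟩ : ∃ x' : G.vertexSet, (x' : α) = x := ⟨⟨x, he.left_mem⟩, rfl⟩
  obtain ⟨y, rfl⟩ : ∃ y' : G.vertexSet, (y' : α) = y := ⟨⟨y, he.right_mem⟩, rfl⟩
  have hxy : x ≠ y := by
    rintro rfl
    exact hG.not_isLoopAt e x he
  set B' : Set G.vertexSet := (↑) ⁻¹' B with hB'
  have hx : x ∉ B' := hx
  have hy : y ∉ B' := hy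
  have hBn : B'.Nontrivial := by
    obtain ⟨u, hu, v, hv, huv⟩ := Set.one_lt_ncard_iff_nontrivial.1 hk
    exact ⟨⟨u, hB hu⟩, hu, ⟨v, hB hv⟩, hv, fun h => huv (congrArg Subtype.val h)⟩
  have hbv : ∀ (v : G.vertexSet) (hv : (v : α) ∈ B), HQD.boundaryValue G b v = b ⟨v, hv⟩ := fun v hv => dif_pos hv
  have hbi : Set.InjOn (HQD.boundaryValue G b) B' := by
    intro u hu v hv huv
    rw [hbv u hu, hbv v hv] at huv
    exact Subtype.ext (congrArg (fun w : B => (w : α)) (hb huv))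
  have hbk : ∀ v ∈ B', HQD.boundaryValue G b v ∈ IntermediateField.adjoin ℚ (Set.range b) := by
    intro v hv
    rw [hbv v hv]
    exact IntermediateField.subset_adjoin ℚ _ ⟨_, rfl⟩
  have hstD : ∀ i : (G.deleteEdges {e}).edgeSet, (G.deleteEdges {e}).IsLink (Equiv.refl _ i) (s i) (t i) :=
    fun i => ⟨hst i, i.2.2⟩
  have := HQD.countable_adjoin (Set.finite_range b).countable
  -- The common base point: generic on `G - e`, where nondegeneracy and properness hold for both
  -- relaxed systems.
  obtain ⟨q₀, -, hq₀⟩ := HQD.GenericIn.exists_mem_nhds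
    (k := IntermediateField.adjoin ℚ (Set.range b)) (HQD.qSumSubmodule (G.deleteEdges {e}) B)
    (zero_mem _) Filter.univ_mem
  have hL : HQD.qSumSubmodule (G.deleteEdges {e}) B = HQD.chargeFree s t B' :=
    SetLike.ext fun q => HQD.qSum_iff_charge (Equiv.refl _) hstD hne
  have hgen := hq₀
  rw [hL] at hgen
  have hsol : HQD.solutions (G.deleteEdges {e}) B b q₀ =
      HQD.fluxSolutions s t B' (HQD.boundaryValue G b) fun i => (q₀ i : ℂ) :=
    HQD.solutions_eq_fluxSolutions (Equiv.refl _) hstD hne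
  obtain ⟨hf1, he1⟩ := hgen.encard_relaxedSolutions hJ hBn hbi hbk hx hy hxy
    (Or.inl ⟨rfl, rfl⟩)
  obtain ⟨hf2, he2⟩ := hgen.encard_relaxedSolutions hJ hBn hbi hbk hx hy hxy
    (Or.inr ⟨rfl, rfl⟩)
  obtain ⟨q₁, hq₁, hn₁⟩ :=
    HQD.exists_isGeneric_encard_eq hst hne hJ hBn.nonempty he hx hy hxy hgen.1 he1
  obtain ⟨q₂, hq₂, hn₂⟩ :=
    HQD.exists_isGeneric_contract_encard_eq hst hx hy hxy hne hgen.1 he2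
  rw [HQD.relaxedSolutions_one_zero_eq_union hx hy hxy (hgen.1 x hx)] at hf1 hn₁
  have hf0 := hf1.subset Set.subset_union_left
  rw [Set.encard_union_eq (hgen.disjoint_relaxedSolutions hJ hBn hbi hbk hx hy hxy),
    ← hf0.cast_ncard_eq, ← hf2.cast_ncard_eq, ← Nat.cast_add] at hn₁
  rw [← hf2.cast_ncard_eq] at hn₂
  have : Finite (HQD.contract G e x y).vertexSet := (hV.image _).to_subtype
  have : Finite (HQD.contract G e x y).edgeSet :=
    inferInstanceAs (Finite (G.deleteEdges {e}).edgeSet)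
  exact ⟨_, _, _, HQD.isGenericCount_of_encard_eq hq₁ hn₁,
    HQD.isGenericCount_of_encard_eq hq₀ ((congrArg Set.encard hsol).trans hf0.cast_ncard_eq.symm),
    HQD.isGenericCount_of_encard_eq hq₂ hn₂, rfl⟩
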